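/- **Setting.** Let $c_0,c_1>0$, $0<z_{int}<z_{tr}$, $\mathbf k_0\in\mathbb R^2$ with $c_j|\mathbf k_0|<1$ for $j=0,1$, and put $$\mathcal s_j=\frac{\sqrt{1-c_j^2|\mathbf k_0|^2}}{c_j},\qquad \mathcal T=\frac{2\sqrt{\mathcal s_0\mathcal s_1}}{\mathcal s_0+\mathcal s_1},\qquad A_j=\frac{1}{c_j^3\mathcal s_j^3}\big(\mathbf I_2-c_j^2\,\mathbf k_0^\perp\otimes\mathbf k_0^\perp\big),\qquad \mathbf k_0^\perp=(-\mathbf k_{0,2},\mathbf k_{0,1})^T,$$ $$\hat{\mathcal U}_j(\omega,\mathbf q,z)=e^{-i\omega z c_j\mathbf q^TA_j\mathbf q/2},\qquad \mathbf x_{int}=\frac{z_{int}}{\mathcal s_0}\mathbf k_0,\qquad \mathbf x_{obs}=\mathbf x_{int}+\frac{z_{tr}-z_{int}}{\mathcal s_1}\mathbf k_0,\qquad t_{obs}=\frac{z_{int}}{c_0^2\mathcal s_0}+\frac{z_{tr}-z_{int}}{c_1^2\mathcal s_1}.$$ Let $V$ be a continuous, strictly stationary random field on $\mathbb R^2$ that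 is $\alpha$-mixing, i.e. $\alpha(r)\to0$ as $r\to\infty$, where $\alpha(r)$ is the supremum of $|\mathbb P(A\cap B)-\mathbb P(A)\mathbb P(B)|$ over nonempty $S,S'\subset\mathbb R^2$ at distance $>r$, $A\in\sigma(V(\mathbf x),\mathbf x\in S)$ and $B\in\sigma(V(\mathbf x),\mathbf x\in S')$. Let $\phi_V(u)=\mathbb E[e^{iuV(0)}]$. Let $\Psi\in L^1(\mathbb R\times\mathbb R^2)$ (real or complex valued) be such that $\hat\Psi(\omega,\mathbf k)=\iint\Psi(t,\mathbf x)e^{i\omega(t-\mathbf k\cdot\mathbf x)}dt\,d\mathbf x$ has compact support in $(\omega,\mathbf k)$ and vanishes for $|\omega|$ small. For $\gamma>1/2$ and $\varepsilon>0$ the transmitted wave in the plane $z=z_{tr}$, given by its leading-order expression, is $$u^{\varepsilon,tr}(t,\mathbf x)=\frac{\mathcal T}{2(2\pi)^3}\sqrt{\frac{\mathcal s_0}{\mathcal s_1}}\iiint e^{-i\omega(t-\mathcal s_0z_{int}-\mathcal s_1(z_{tr}-z_{int})-\mathbf x\cdot\mathbf k_0)/\varepsilon}\,e^{i\omega\mathbf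 q\cdot(\mathbf x-\mathbf x_{obs})/\sqrt\varepsilon}\,K^\varepsilon(\omega,\mathbf q,\mathbf q')\,\hat{\mathcal U}_1(\omega,\mathbf q,z_{tr}-z_{int})\,\hat{\mathcal U}_0(\omega,\mathbf q',z_{int})\,\hat\Psi(\omega,\mathbf q')\,\omega^2\,d\omega\,d\mathbf q'\,d\mathbf q,$$ $$K^\varepsilon(\omega,\mathbf q,\mathbf q')=\frac{\omega^2}{\varepsilon(2\pi)^2}\int_{\mathbb R^2}e^{i\omega(\mathbf q'-\mathbf q)\cdot(\mathbf x'-\mathbf x_{int})/\sqrt\varepsilon}\,e^{i\omega(\mathcal s_0-\mathcal s_1)V(\mathbf x'/\varepsilon^\gamma)}\,d\mathbf x',$$ an oscillatory integral that is understood, after testing in $(t,\mathbf x)$, by integrating in $\mathbf q$ and $\mathbf q'$ before $\mathbf x'$ and $\omega$. The specular transmitted wave front, with $(s,\mathbf y,\widetilde{\mathbf y})\in\mathbb X=\mathbb R\times\mathbb R^2\times\mathbb R^2$, is $$U^{\varepsilon,tr}(s,\mathbf y,\widetilde{\mathbf y})=u^{\varepsilon,tr}\big(t_{obs}+\sqrt\varepsilon\,\mathbf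 k_0\cdot\mathbf y+\varepsilon^\gamma\mathbf k_0\cdot\widetilde{\mathbf y}+\varepsilon s,\ \mathbf x_{obs}+\sqrt\varepsilon\,\mathbf y+\varepsilon^\gamma\widetilde{\mathbf y}\big).$$ **Proposition.** For every $\gamma>1/2$ the integrals defining the pairing of $U^{\varepsilon,tr}$ with a Schwartz function converge absolutely in the above order, $U^{\varepsilon,tr}$ is a random tempered distribution on $\mathbb X$ for every $\varepsilon>0$ and every realization of $V$, and, as $\varepsilon\to0^+$, $U^{\varepsilon,tr}$ converges in probability in $\mathcal S'(\mathbb X)$ (for the strong topology, hence also against each test function) to the deterministic profile $$U^{tr}(s,\mathbf y)=\frac{\mathcal T}{2(2\pi)^3}\sqrt{\frac{\mathcal s_0}{\mathcal s_1}}\iint e^{-i\omega(s-\mathbf q\cdot\mathbf y)}\,\hat{\mathcal U}_1(\omega,\mathbf q,z_{tr}-z_{int})\,\hat{\mathcal U}_0(\omega,\mathbf q,z_{int})\,\phi_V\big(\omega(\mathcal s_0-\mathcal s_1)\big)\,\hat\Psi(\omega,\mathbf q)\,\omega^2\,d\omega\,d\mathbf q,$$ an absolutely convergent integral that does not depend on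 $\widetilde{\mathbf y}$. That is, for every neighbourhood $N$ of $U^{tr}$ in $\mathcal S'(\mathbb X)$, $\mathbb P(U^{\varepsilon,tr}\notin N)\to0$. -/

import Mathlib

open MeasureTheory Filter Topology
open scoped SchwartzMap Matrix InnerProductSpace

namespace RoughInterface

noncomputable section

/-- The transverse plane `ℝ²` with its Euclidean structure. -/
abbrev Plane : Type := EuclideanSpace ℝ (Fin 2)

/-- The space `𝕏 = ℝ × ℝ² × ℝ²` of the variables `(s, y, ỹ)`. -/
abbrev ObsSpace : Type := ℝ × Plane × Plane

/-- The tempered distributions on `𝕏`: the topological dual of the Schwartz space, with the strong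
dual topology (uniform convergence on bounded sets of test functions). Convergence in it implies
convergence against every single test function. -/
abbrev TemperedDist : Type := 𝓢(ObsSpace, ℂ) →L[ℂ] ℂ

/-! ### The random interface -/

section Randomness

variable {Ω : Type*} [MeasurableSpace Ω]

/-- Strict stationarity: all translates of the field have the same law (on `ℝ^(ℝ²)` with the
product `σ`-algebra, i.e. the same finite-dimensional distributions). -/
def IsStationary (P : Measure Ω) (V : Ω → Plane → ℝ) : Prop :=
  ∀ h : Plane, P.map (fun w x => V w (x + h)) = P.map (fun w x => V w x)

/-- The `σ`-algebra generated by `V(x)`, `x ∈ S`. -/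
abbrev fieldSigma (V : Ω → Plane → ℝ) (S : Set Plane) : MeasurableSpace Ω :=
  ⨆ x ∈ S, MeasurableSpace.comap (fun w => V w x) inferInstance

/-- The distance `inf {|s - s'| : s ∈ S, s' ∈ S'}` between two (nonempty) sets. -/
def setDist (S S' : Set Plane) : ℝ :=
  sInf {d : ℝ | ∃ s ∈ S, ∃ s' ∈ S', d = dist s s'}

/-- The `α`-mixing coefficient `α(r)`: the supremum of `|P(A ∩ B) - P(A) P(B)|` over nonempty
`S, S'` with `d(S, S') > r` and events `A ∈ σ(V(x), x ∈ S)`, `B ∈ σ(V(x), x ∈ S')`. -/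
def alphaMixing (P : Measure Ω) (V : Ω → Plane → ℝ) (r : ℝ) : ℝ :=
  sSup {a : ℝ | ∃ S S' : Set Plane, S.Nonempty ∧ S'.Nonempty ∧ r < setDist S S' ∧
    ∃ A B : Set Ω, MeasurableSet[fieldSigma V S] A ∧ MeasurableSet[fieldSigma V S'] B ∧
      a = |P.real (A ∩ B) - P.real A * P.real B|}

/-- A continuous, stationary, `α`-mixing random field on the plane. -/
structure IsMixingField (P : Measure Ω) (V : Ω → Plane → ℝ) : Prop where
  measurable : ∀ x, Measurable fun w => V w x
  continuous : ∀ w, Continuous (V w)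
  stationary : IsStationary P V
  mixing : Tendsto (alphaMixing P V) atTop (𝓝 0)

/-- The characteristic function `φ_V(u) = 𝔼[exp(i u V(0))]`. -/
def elevationCharFun (P : Measure Ω) (V : Ω → Plane → ℝ) (u : ℝ) : ℂ :=
  ∫ w, Complex.exp (Complex.I * u * V w 0) ∂P

end Randomness

/-! ### The source -/

/-- The Fourier transform `Ψ̂(ω, k) = ∬ Ψ(t, x) exp(i ω (t - k·x)) dt dx` of the source profile. -/
def sourceTransform (Ψ : ℝ × Plane → ℂ) (ω : ℝ) (k : Plane) : ℂ :=
  ∫ p : ℝ × Plane, Ψ p * Complex.exp (Complex.I * ω * ((p.1 - ⟪k, p.2⟫_ℝ : ℝ) : ℂ))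

/-- Source profiles: integrable, with `Ψ̂` compactly supported in `(ω, k)` and the support bounded
away from `ω = 0`. -/
structure IsAdmissibleSource (Ψ : ℝ × Plane → ℂ) : Prop where
  integrable : Integrable Ψ
  compactSupport : HasCompactSupport fun p : ℝ × Plane => sourceTransform Ψ p.1 p.2
  awayFromZero : ∃ δ : ℝ, 0 < δ ∧ ∀ ω k, |ω| < δ → sourceTransform Ψ ω k = 0

/-! ### The deterministic setup -/

/-- Two homogeneous media with wave speeds `c 0` (source side) and `c 1`, mean interface plane
`z = zInt`, observation plane `z = zTr`, and lateral slowness vector `k₀` of the incident beam,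
which is propagating in both media. -/
structure Setup where
  c : Fin 2 → ℝ
  zInt : ℝ
  zTr : ℝ
  k₀ : Plane
  c_pos : ∀ j, 0 < c j
  zInt_pos : 0 < zInt
  zInt_lt_zTr : zInt < zTr
  propagating : ∀ j, c j * ‖k₀‖ < 1

namespace Setup

variable (M : Setup)

/-- The vertical slowness `𝓈_j = √(1 - c_j² |k₀|²) / c_j`. -/
def slow (j : Fin 2) : ℝ := √(1 - M.c j ^ 2 * ‖M.k₀‖ ^ 2) / M.c j

/-- The matrix `A_j` of the paraxial propagation in medium `j`. -/
def A (j : Fin 2) : Matrix (Fin 2) (Fin 2) ℝ :=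
  ((1 - M.c j ^ 2 * ‖M.k₀‖ ^ 2) ^ (3 / 2 : ℝ))⁻¹ •
    !![1 - M.c j ^ 2 * M.k₀ 1 ^ 2, M.c j ^ 2 * M.k₀ 0 * M.k₀ 1;
       M.c j ^ 2 * M.k₀ 0 * M.k₀ 1, 1 - M.c j ^ 2 * M.k₀ 0 ^ 2]

/-- The paraxial propagator `𝒰̂_j(ω, q, z) = exp(-i ω z c_j qᵀ A_j q / 2)`. -/
def propagator (j : Fin 2) (ω : ℝ) (q : Plane) (z : ℝ) : ℂ :=
  Complex.exp (-Complex.I * ω * z * M.c j * ((q.ofLp ⬝ᵥ (M.A j *ᵥ q.ofLp) : ℝ) : ℂ) / 2)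

/-- The transmission coefficient `𝒯 = 2 √(𝓈₀ 𝓈₁) / (𝓈₀ + 𝓈₁)`. -/
def transCoeff : ℝ := 2 * √(M.slow 0 * M.slow 1) / (M.slow 0 + M.slow 1)

/-- The prefactor `𝒯 / (2 (2π)³) · √(𝓈₀/𝓈₁)`. -/
def prefactor : ℝ :=
  M.transCoeff / (2 * (2 * Real.pi) ^ 3) * √(M.slow 0 / M.slow 1)

/-- Lateral position at which the incident pulse hits the interface. -/
def xInt : Plane := (M.zInt / M.slow 0) • M.k₀

/-- Lateral position at which the transmitted pulse is observed in the plane `z = zTr`. -/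
def xObs : Plane := M.xInt + ((M.zTr - M.zInt) / M.slow 1) • M.k₀

/-- Travel time from the source to the observation point. -/
def tObs : ℝ :=
  M.zInt / (M.c 0 ^ 2 * M.slow 0) + (M.zTr - M.zInt) / (M.c 1 ^ 2 * M.slow 1)

/-! ### The transmitted wave -/

/-- The oscillating factor of the transmitted mode `(ω, q)` at time `t`, lateral position `x`, in
the plane `z = zTr`. -/
def mode (ε ω : ℝ) (q : Plane) (t : ℝ) (x : Plane) : ℂ :=
  Complex.exp (-Complex.I * ω *
      ((t - M.slow 0 * M.zInt - M.slow 1 * (M.zTr - M.zInt) - ⟪x, M.k₀⟫_ℝ : ℝ) : ℂ) / ε) *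
    Complex.exp (Complex.I * ω * ((⟪q, x - M.xObs⟫_ℝ : ℝ) : ℂ) / (√ε : ℝ))

/-- Observation time `t_obs + √ε k₀·y + ε^γ k₀·ỹ + ε s`. -/
def obsTime (γ ε : ℝ) (p : ObsSpace) : ℝ :=
  M.tObs + √ε * ⟪M.k₀, p.2.1⟫_ℝ + ε ^ γ * ⟪M.k₀, p.2.2⟫_ℝ + ε * p.1

/-- Observation point `x_obs + √ε y + ε^γ ỹ`. -/
def obsPoint (γ ε : ℝ) (p : ObsSpace) : Plane :=
  M.xObs + √ε • p.2.1 + ε ^ γ • p.2.2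

/-- The integrand (in the interface point `x'`) of the pairing of the kernel `K^ε(τ, ω, q, q')`
with `F(q) G(q')`, for the interface profile `v`. -/
def scatterIntegrand (γ ε τ ω : ℝ) (v : Plane → ℝ) (F G : Plane → ℂ) (x' : Plane) : ℂ :=
  Complex.exp (Complex.I * ω * τ * v ((ε ^ γ)⁻¹ • x')) *
    (∫ q : Plane, Complex.exp (-Complex.I * ω * ((⟪q, x' - M.xInt⟫_ℝ : ℝ) : ℂ) / (√ε : ℝ)) * F q) *
    (∫ q' : Plane, Complex.exp (Complex.I * ω * ((⟪q', x' - M.xInt⟫_ℝ : ℝ) : ℂ) / (√ε : ℝ)) * G q')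

/-- The scattering operator as a bilinear form, `∬ K^ε(τ, ω, q, q') F(q) G(q') dq dq'`, where
`K^ε(τ, ω, q, q')` is the (distributional) kernel
`ω² / (ε (2π)²) ∫ exp(i ω (q' - q)·(x' - x_int)/√ε) exp(i ω τ v(x'/ε^γ)) dx'`. -/
def scatter (γ ε τ ω : ℝ) (v : Plane → ℝ) (F G : Plane → ℂ) : ℂ :=
  ((ω ^ 2 / (ε * (2 * Real.pi) ^ 2) : ℝ) : ℂ) *
    ∫ x' : Plane, M.scatterIntegrand γ ε τ ω v F G x'

/-- Incident amplitude at the interface: `𝒰̂₀(ω, q', zInt) Ψ̂(ω, q')`. -/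
def incoming (Ψ : ℝ × Plane → ℂ) (ω : ℝ) (q' : Plane) : ℂ :=
  M.propagator 0 ω q' M.zInt * sourceTransform Ψ ω q'

/-- The transmitted mode `𝒰̂₁(ω, q, zTr - zInt) · mode(ω, q)`, observed in the variables
`(s, y, ỹ)` and integrated against the test function `φ`. -/
def testedMode (γ ε : ℝ) (φ : 𝓢(ObsSpace, ℂ)) (ω : ℝ) (q : Plane) : ℂ :=
  M.propagator 1 ω q (M.zTr - M.zInt) *
    ∫ p : ObsSpace, M.mode ε ω q (M.obsTime γ ε p) (M.obsPoint γ ε p) * φ p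

/-- The frequency integrand of `⟨U^{ε,tr}, φ⟩`. -/
def frontIntegrand (γ ε : ℝ) (Ψ : ℝ × Plane → ℂ) (v : Plane → ℝ) (φ : 𝓢(ObsSpace, ℂ)) (ω : ℝ) :
    ℂ :=
  M.scatter γ ε (M.slow 0 - M.slow 1) ω v (M.testedMode γ ε φ ω) (M.incoming Ψ ω) *
    ((ω ^ 2 : ℝ) : ℂ)

/-- The pairing `⟨U^{ε,tr}, φ⟩` of the specular transmitted wave front
`U^{ε,tr}(s, y, ỹ) = u^{ε,tr}(obsTime, obsPoint, zTr)`, for the interface profile `v`, where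
`u^{ε,tr}(t, x, zTr)` is the oscillatory integral
`prefactor · ∭ mode(ω, q, t, x) K^ε(𝓈₀ - 𝓈₁, ω, q, q') 𝒰̂₁(ω, q) 𝒰̂₀(ω, q') Ψ̂(ω, q') ω² dω dq' dq`. -/
def frontPairing (γ ε : ℝ) (Ψ : ℝ × Plane → ℂ) (v : Plane → ℝ) (φ : 𝓢(ObsSpace, ℂ)) : ℂ :=
  (M.prefactor : ℂ) * ∫ ω : ℝ, M.frontIntegrand γ ε Ψ v φ ω

/-- All the integrals that enter `frontPairing` converge absolutely. -/
def FrontConverges (γ ε : ℝ) (Ψ : ℝ × Plane → ℂ) (v : Plane → ℝ) (φ : 𝓢(ObsSpace, ℂ)) : Prop :=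
  (∀ ω : ℝ, ω ≠ 0 →
    Integrable (M.testedMode γ ε φ ω) ∧ Integrable (M.incoming Ψ ω) ∧
      Integrable (M.scatterIntegrand γ ε (M.slow 0 - M.slow 1) ω v
        (M.testedMode γ ε φ ω) (M.incoming Ψ ω))) ∧
    Integrable (M.frontIntegrand γ ε Ψ v φ)

/-! ### The homogenized profile -/

/-- The integrand of the homogenized profile at `(s, y)`, as a function of `(ω, q)`, with filter
`χ`. -/
def profileIntegrand (Ψ : ℝ × Plane → ℂ) (χ : ℝ → ℂ) (s : ℝ) (y : Plane) (p : ℝ × Plane) : ℂ :=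
  Complex.exp (-Complex.I * p.1 * ((s - ⟪p.2, y⟫_ℝ : ℝ) : ℂ)) *
    M.propagator 1 p.1 p.2 (M.zTr - M.zInt) * M.propagator 0 p.1 p.2 M.zInt *
    χ (p.1 * (M.slow 0 - M.slow 1)) * sourceTransform Ψ p.1 p.2 * ((p.1 ^ 2 : ℝ) : ℂ)

/-- The transmitted profile `U^{tr}(s, y)` with filter `χ` (for `χ = 1` it is the transmitted
profile of a flat interface). -/
def profile (Ψ : ℝ × Plane → ℂ) (χ : ℝ → ℂ) (s : ℝ) (y : Plane) : ℂ :=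
  (M.prefactor : ℂ) * ∫ p : ℝ × Plane, M.profileIntegrand Ψ χ s y p

end Setup

/-- Convergence in probability, as `ε → 0⁺`, of random tempered distributions to a deterministic
one: the probability of lying outside any given neighbourhood of the limit tends to `0`. -/
def TendstoInProbability {Ω : Type*} [MeasurableSpace Ω] (P : Measure Ω)
    (Uε : ℝ → Ω → TemperedDist) (U : TemperedDist) : Prop :=
  ∀ N ∈ 𝓝 U, Tendsto (fun ε => P {w | Uε ε w ∉ N}) (𝓝[>] 0) (𝓝 0)

end

end RoughInterface

/-! Substituting `x' = x_int + (2π√ε/ω) η` in the interface integral absorbs the prefactor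
`ω²/(ε(2π)²)` into the Jacobian. It also turns the `q` and `q'` integrals into `𝓕 F(η)` and `𝓕⁻
G(η)`, where `F` is the tested transmitted mode and `G` the incident amplitude (`scatter_eq`). The
scattering form is then the integral of `𝓕 F · 𝓕⁻ G` against a phase of modulus one, sampled from
the interface at points spread by `scaleRatio`, of order `ε^(1/2-γ)`.

Two facts follow. By Cauchy-Schwarz and Plancherel, the form is at most `‖F‖₂ ‖G‖₂` for every
realization (`enorm_scatter_le`). Since `γ > 1/2`, the sampling points separate, so the phase
averages to its mean `φ_V`. This is a second-moment law of large numbers: covariances vanish off the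
diagonal by mixing, and dominated convergence needs no mixing rate (`tendsto_lintegral_average`).
Parseval identifies the averaged form with `φ_V ∫ F G`.

The mode `F` depends on `ε` only through `δ = ε^γ/√ε`, which tends to zero. It converges in `L²` to
its value at `δ = 0`, which removes `ỹ` from the limit. The source confines `ω` to a compact set
away from zero, so integration over frequency preserves convergence in `L¹(P)`
(`tendsto_lintegral_frontPairing`).

For the strong topology, all pairings are bounded, uniformly in `ε` and the realization, by a
weighted sup norm of the Fourier transform of the test function (`exists_integrand_bound`). Bounded
sets of Schwartz functions are totally bounded in that norm, so a finite net and a union bound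
reduce the claim to single test functions (`tendstoInProbability_of_forall`). -/

namespace RoughInterface

/-! ### Plancherel for integrable, square integrable functions -/

section Plancherel

open FourierTransform ComplexConjugate

variable {E : Type*} [NormedAddCommGroup E] [InnerProductSpace ℝ E] [FiniteDimensional ℝ E]
  [MeasurableSpace E] [BorelSpace E]

theorem continuous_fourier_of_integrable {f : E → ℂ} (h1 : Integrable f) : Continuous (𝓕 f) :=
  VectorFourier.fourierIntegral_continuous Real.continuous_fourierChar
    (by exact continuous_inner) h1

/-- The `L²` transform and the integral transform define the same distribution. Against a smooth
compactly supported function, the multiplication formula moves either transform onto the test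
function, and locally integrable functions with equal pairings agree almost everywhere. -/
theorem fourier_toLp_ae_eq {f : E → ℂ} (h1 : Integrable f) (h2 : MemLp f 2) :
    ((𝓕 (h2.toLp f) : Lp ℂ 2 (volume : Measure E)) : E → ℂ) =ᵐ[volume] 𝓕 f := by
  have hcont := continuous_fourier_of_integrable h1
  refine ae_eq_of_integral_contDiff_smul_eq
    ((Lp.memLp _).locallyIntegrable (by norm_num)) hcont.locallyIntegrable ?_
  intro g hg hgs
  have hgs' : HasCompactSupport (fun x => (g x : ℂ)) :=
    hgs.comp_left (g := fun r : ℝ => (r : ℂ)) (by simp)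
  let G : 𝓢(E, ℂ) := hgs'.toSchwartzMap (Complex.ofRealCLM.contDiff.comp hg)
  have h := congrArg (fun T => T G) (Lp.fourier_toTemperedDistribution_eq (h2.toLp f))
  simp only [TemperedDistribution.fourier_apply, Lp.toTemperedDistribution_apply] at h
  have hG : ∀ x, G x = (g x : ℂ) := fun x => rfl
  have e1 : ∫ x, (𝓕 G) x • (h2.toLp f : E → ℂ) x = ∫ x, (𝓕 (G : E → ℂ)) x • f x := by
    refine integral_congr_ae ?_
    filter_upwards [h2.coeFn_toLp] with x hx
    rw [hx, SchwartzMap.fourier_coe]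
  have e2 : ∫ x, (𝓕 (G : E → ℂ)) x • f x = ∫ x, G x • (𝓕 f) x := by
    have := VectorFourier.integral_fourierIntegral_smul_eq_flip (L := innerₗ E)
      (μ := (volume : Measure E)) (ν := (volume : Measure E))
      Real.continuous_fourierChar (by exact continuous_inner) G.integrable h1
    rw [flip_innerₗ] at this
    exact this
  have e3 : ∀ F : E → ℂ, ∫ x, G x • F x = ∫ x, g x • F x := fun F => by
    simp_rw [hG]; rfl
  rw [← e3, ← e3, ← h, e1, e2]

theorem memLp_fourier {f : E → ℂ} (h1 : Integrable f) (h2 : MemLp f 2) : MemLp (𝓕 f) 2 :=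
  (memLp_congr_ae (fourier_toLp_ae_eq h1 h2)).1 (Lp.memLp _)

theorem eLpNorm_fourier {f : E → ℂ} (h1 : Integrable f) (h2 : MemLp f 2) :
    eLpNorm (𝓕 f) 2 volume = eLpNorm f 2 volume := by
  rw [← eLpNorm_congr_ae (fourier_toLp_ae_eq h1 h2), ← eLpNorm_congr_ae h2.coeFn_toLp]
  have := Lp.norm_fourier_eq (h2.toLp f)
  rw [Lp.norm_def, Lp.norm_def] at this
  exact (ENNReal.toReal_eq_toReal_iff' (Lp.eLpNorm_ne_top _) (Lp.eLpNorm_ne_top _)).1 this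

/-- Conjugation exchanges the two transforms, so the `L²` statements for `𝓕⁻` follow from those for
`𝓕`. -/
theorem conj_fourier_conj (f : E → ℂ) (x : E) : conj (𝓕 (fun y => conj (f y)) x) = 𝓕⁻ f x := by
  rw [Real.fourier_eq', Real.fourierInv_eq', ← integral_conj]
  refine integral_congr_ae (ae_of_all _ fun y => ?_)
  simp only [smul_eq_mul, map_mul, Complex.conj_conj, ← Complex.exp_conj]
  simp [map_ofNat]

theorem integrable_conj_comp {f : E → ℂ} (h1 : Integrable f) : Integrable fun y => conj (f y) :=
  (LinearIsometryEquiv.integrable_comp_iff (RCLike.conjLIE (K := ℂ))).2 h1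

theorem eLpNorm_conj_comp (f : E → ℂ) :
    eLpNorm (fun y => conj (f y)) 2 volume = eLpNorm f 2 volume :=
  eLpNorm_congr_norm_ae (ae_of_all _ fun y => by simp)

theorem memLp_fourierInv {f : E → ℂ} (h1 : Integrable f) (h2 : MemLp f 2) : MemLp (𝓕⁻ f) 2 := by
  have := (memLp_fourier (integrable_conj_comp h1) h2.star).star
  refine (memLp_congr_ae (ae_of_all _ fun x => ?_)).1 this
  exact conj_fourier_conj f x

theorem eLpNorm_fourierInv {f : E → ℂ} (h1 : Integrable f) (h2 : MemLp f 2) :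
    eLpNorm (𝓕⁻ f) 2 volume = eLpNorm f 2 volume := by
  rw [← eLpNorm_conj_comp f, ← eLpNorm_fourier (integrable_conj_comp h1) h2.star]
  exact eLpNorm_congr_norm_ae (ae_of_all _ fun x => by rw [← conj_fourier_conj f x]; simp)

/-- Parseval's formula. -/
theorem integral_fourier_mul_fourierInv {f g : E → ℂ} (hf : Integrable f) (hf2 : MemLp f 2)
    (hg : Integrable g) (hg2 : MemLp g 2) : ∫ x, 𝓕 f x * 𝓕⁻ g x = ∫ x, f x * g x := by
  have hgs : MemLp (fun x => conj (g x)) 2 := hg2.star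
  have h := Lp.inner_fourier_eq (hgs.toLp _) (hf2.toLp f)
  rw [MeasureTheory.L2.inner_def, MeasureTheory.L2.inner_def] at h
  calc ∫ x, 𝓕 f x * 𝓕⁻ g x = _ := ?_
    _ = _ := h
    _ = _ := ?_
  · refine integral_congr_ae ?_
    filter_upwards [fourier_toLp_ae_eq hf hf2,
      fourier_toLp_ae_eq (integrable_conj_comp hg) hgs] with x h1 h2
    rw [h1, h2, ← conj_fourier_conj g x]
    simp
  · refine integral_congr_ae ?_
    filter_upwards [hf2.coeFn_toLp, hgs.coeFn_toLp] with x h1 h2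
    rw [h1, h2]
    simp

/-- Cauchy-Schwarz followed by Plancherel. The absolute value inside the integral matters: the bound
survives multiplication by any phase of modulus one. -/
theorem lintegral_fourier_mul_fourierInv_le {f g : E → ℂ} (hf : Integrable f) (hf2 : MemLp f 2)
    (hg : Integrable g) (hg2 : MemLp g 2) :
    ∫⁻ x, ‖𝓕 f x * 𝓕⁻ g x‖ₑ ≤ eLpNorm f 2 volume * eLpNorm g 2 volume := by
  have := eLpNorm_smul_le_mul_eLpNorm (p := 2) (q := 2) (r := 1)
    (memLp_fourierInv hg hg2).1 (memLp_fourier hf hf2).1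
  rw [eLpNorm_one_eq_lintegral_enorm, eLpNorm_fourier hf hf2, eLpNorm_fourierInv hg hg2] at this
  exact this

theorem integrable_fourier_mul_fourierInv {f g : E → ℂ} (hf : Integrable f) (hf2 : MemLp f 2)
    (hg : Integrable g) (hg2 : MemLp g 2) : Integrable fun x => 𝓕 f x * 𝓕⁻ g x :=
  (memLp_fourier hf hf2).integrable_mul (memLp_fourierInv hg hg2)

end Plancherel

/-! ### Bounded sets of Schwartz functions are totally bounded in weighted sup norms -/

section TotallyBounded

variable {E : Type*} [NormedAddCommGroup E] [NormedSpace ℝ E]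

theorem exists_seminorm_le_of_isVonNBounded {B : Set 𝓢(E, ℂ)} (hB : Bornology.IsVonNBounded ℂ B)
    (m : ℕ × ℕ) :
    ∃ C > 0, ∀ f ∈ B, ((Finset.Iic m).sup (schwartzSeminormFamily ℂ E ℂ)) f ≤ C := by
  obtain ⟨C, hC, h⟩ :=
    ((schwartz_withSeminorms ℂ E ℂ).isVonNBounded_iff_finset_seminorm_bounded).1 hB (Finset.Iic m)
  exact ⟨C, hC, fun f hf => (h f hf).le⟩

theorem one_add_norm_pow_mul_le (k : ℕ) (f : 𝓢(E, ℂ)) (x : E) :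
    (1 + ‖x‖) ^ k * ‖f x‖ ≤
      2 ^ k * ((Finset.Iic (k, 0)).sup (schwartzSeminormFamily ℂ E ℂ)) f := by
  have := SchwartzMap.one_add_le_sup_seminorm_apply (𝕜 := ℂ) (m := (k, 0)) le_rfl le_rfl f x
  rwa [norm_iteratedFDeriv_zero] at this

/-- An Arzelà-Ascoli argument. One spare power of decay makes the weighted tail small outside a
ball. Inside it, a uniform Lipschitz constant reduces functions to their values on a finite net of
points, where boundedness is total boundedness. -/
theorem exists_finite_approx_of_isVonNBounded [FiniteDimensional ℝ E] {B : Set 𝓢(E, ℂ)}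
    (hB : Bornology.IsVonNBounded ℂ B) (k : ℕ) {r : ℝ} (hr : 0 < r) :
    ∃ T ⊆ B, T.Finite ∧ ∀ f ∈ B, ∃ g ∈ T, ∀ x, (1 + ‖x‖) ^ k * ‖(f - g) x‖ ≤ r := by
  obtain ⟨C, hC, hCB⟩ := exists_seminorm_le_of_isVonNBounded hB (k + 1, 0)
  obtain ⟨L, hL, hLB⟩ := exists_seminorm_le_of_isVonNBounded hB (0, 1)
  have hdec : ∀ f ∈ B, ∀ x, (1 + ‖x‖) ^ (k + 1) * ‖f x‖ ≤ 2 ^ (k + 1) * C := fun f hf x =>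
    (one_add_norm_pow_mul_le (k + 1) f x).trans (by gcongr; exact hCB f hf)
  have hlip : ∀ f ∈ B, ∀ x y, ‖f x - f y‖ ≤ L * ‖x - y‖ := by
    intro f hf x y
    refine Convex.norm_image_sub_le_of_norm_fderiv_le (𝕜 := ℝ) (s := Set.univ)
      (fun z _ => f.differentiableAt) (fun z _ => ?_) convex_univ (Set.mem_univ _) (Set.mem_univ _)
    have := SchwartzMap.one_add_le_sup_seminorm_apply (𝕜 := ℂ) (m := (0, 1)) (k := 0) (n := 1)
      le_rfl le_rfl f z
    simp only [pow_zero, one_mul, norm_iteratedFDeriv_one] at this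
    exact this.trans (hLB f hf)
  -- Beyond radius `R` the spare power `1 + ‖x‖` absorbs the decay bounds of both functions.
  obtain ⟨R, hR0, hR⟩ : ∃ R : ℝ, 0 < R ∧ 2 * (2 ^ (k + 1) * C) ≤ r * (1 + R) := by
    refine ⟨2 * (2 ^ (k + 1) * C) / r, by positivity, ?_⟩
    rw [mul_add, mul_div_cancel₀ _ hr.ne']
    linarith
  -- Two Lipschitz moves and one comparison at a net point cost at most `3a`, while the weight on
  -- the ball is at most `(1 + R)^k`.
  set a : ℝ := r / (3 * (1 + R) ^ k) with ha
  have ha0 : 0 < a := by positivity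
  have hball : IsCompact (Metric.closedBall (0 : E) R) :=
    have := FiniteDimensional.proper_real E; isCompact_closedBall _ _
  obtain ⟨t, -, htf, hcov⟩ := hball.finite_cover_balls (e := a / (2 * L)) (by positivity)
  have := htf.fintype
  let ev : 𝓢(E, ℂ) → (t → ℂ) := fun f x => f x
  have hbdd : Bornology.IsBounded (ev '' B) := by
    refine (Metric.isBounded_iff_subset_closedBall 0).2 ⟨2 ^ (k + 1) * C, ?_⟩
    rintro _ ⟨f, hf, rfl⟩
    rw [mem_closedBall_zero_iff, pi_norm_le_iff_of_nonneg (by positivity)]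
    intro x
    refine le_trans ?_ (hdec f hf x)
    exact le_mul_of_one_le_left (norm_nonneg _) (one_le_pow₀ (by linarith [norm_nonneg (x : E)]))
  have htb : TotallyBounded (ev '' B) :=
    hbdd.isCompact_closure.totallyBounded.subset subset_closure
  obtain ⟨s, hsB, hsf, hs⟩ := Metric.finite_approx_of_totallyBounded htb a ha0
  obtain ⟨T, hTB, hTf, rfl⟩ := 
    (Set.exists_subset_image_finite_and (f := ev) (s := B) (p := fun u => u = s)).1
      ⟨s, hsB, hsf, rfl⟩
  refine ⟨T, hTB, hTf, fun f hf => ?_⟩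
  obtain ⟨_, ⟨g, hg, rfl⟩, hfg⟩ := Set.mem_iUnion₂.1 (hs ⟨f, hf, rfl⟩)
  refine ⟨g, hg, fun x => ?_⟩
  have hgB := hTB hg
  rw [sub_apply]
  rcases le_or_gt ‖x‖ R with hx | hx
  · obtain ⟨y, hy, hxy⟩ := Set.mem_iUnion₂.1 (hcov (mem_closedBall_zero_iff.2 hx))
    rw [Metric.mem_ball, dist_eq_norm] at hxy
    have h1 : ‖f y - g y‖ ≤ a := by
      have := (dist_pi_lt_iff ha0).1 (Metric.mem_ball.1 hfg) ⟨y, hy⟩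
      rw [dist_eq_norm] at this
      exact this.le
    have h2 : L * ‖x - y‖ ≤ a / 2 := by
      calc L * ‖x - y‖ ≤ L * (a / (2 * L)) := by gcongr
        _ = a / 2 := by field_simp
    have h3 : ‖f x - g x‖ ≤ 3 * a := by
      have e : f x - g x = (f x - f y) + (f y - g y) - (g x - g y) := by ring
      rw [e]
      have := norm_sub_le ((f x - f y) + (f y - g y)) (g x - g y)
      have := norm_add_le (f x - f y) (f y - g y)
      linarith [hlip f hf x y, hlip g hgB x y]
    calc (1 + ‖x‖) ^ k * ‖f x - g x‖ ≤ (1 + R) ^ k * (3 * a) := by gcongr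
      _ = r := by rw [ha]; field_simp
  · have h1 : (1 + ‖x‖) ^ (k + 1) * ‖f x - g x‖ ≤ r * (1 + ‖x‖) := by
      calc (1 + ‖x‖) ^ (k + 1) * ‖f x - g x‖
          ≤ (1 + ‖x‖) ^ (k + 1) * (‖f x‖ + ‖g x‖) := by gcongr; exact norm_sub_le _ _
        _ ≤ 2 * (2 ^ (k + 1) * C) := by linarith [hdec f hf x, hdec g hgB x]
        _ ≤ r * (1 + R) := hR
        _ ≤ r * (1 + ‖x‖) := by gcongr
    have h2 : 0 < 1 + ‖x‖ := by positivity
    rw [pow_succ, mul_right_comm] at h1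
    exact le_of_mul_le_mul_right h1 h2

end TotallyBounded

/-! ### The Fourier transform on the space of observation variables -/

/-- The observation space with its Euclidean structure. -/
abbrev EuclideanObs : Type := WithLp 2 (ℝ × WithLp 2 (Plane × Plane))

/-- The identity from the Euclidean version of the observation space. -/
noncomputable def obsEquiv : EuclideanObs ≃L[ℝ] ObsSpace :=
  (WithLp.prodContinuousLinearEquiv 2 ℝ ℝ (WithLp 2 (Plane × Plane))).trans
    ((ContinuousLinearEquiv.refl ℝ ℝ).prodCongr (WithLp.prodContinuousLinearEquiv 2 ℝ Plane Plane))

/-- The sup norm on the product carries no inner product, so Fourier transforms are taken on the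
Euclidean copy. Measure preservation brings the integrals back. -/
theorem measurePreserving_obsEquiv : MeasurePreserving obsEquiv :=
  ((MeasurePreserving.id volume).prod (WithLp.volume_preserving_ofLp Plane Plane)).comp
    (WithLp.volume_preserving_ofLp ℝ (WithLp 2 (Plane × Plane)))

theorem integrable_testFunction (φ : 𝓢(ObsSpace, ℂ)) : Integrable φ :=
  (measurePreserving_obsEquiv.integrable_comp_emb
    obsEquiv.toHomeomorph.measurableEmbedding).1
    (SchwartzMap.compCLMOfContinuousLinearEquiv ℂ obsEquiv φ).integrable

/-- The Fourier transform of a test function on the observation space. -/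
noncomputable def obsFourier : 𝓢(ObsSpace, ℂ) →L[ℂ] 𝓢(EuclideanObs, ℂ) :=
  (FourierTransform.fourierCLM ℂ 𝓢(EuclideanObs, ℂ)).comp
    (SchwartzMap.compCLMOfContinuousLinearEquiv ℂ obsEquiv)

/-- The Fourier variable dual to `(s, y, ỹ)` for the mode `exp(-i ω (s - q·y - δ q·ỹ))`. -/
noncomputable def obsFreq (δ ω : ℝ) (q : Plane) : EuclideanObs :=
  obsEquiv.symm (ω / (2 * Real.pi), -(ω / (2 * Real.pi)) • q, -(δ * ω / (2 * Real.pi)) • q)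

/-- The pairing of a test function with the mode `exp(-i ω (s - q·y - δ q·ỹ))`. -/
noncomputable def modeTransform (δ : ℝ) (φ : 𝓢(ObsSpace, ℂ)) (ω : ℝ) (q : Plane) : ℂ :=
  ∫ p : ObsSpace,
    Complex.exp (-Complex.I * ω * ((p.1 - ⟪q, p.2.1⟫_ℝ - δ * ⟪q, p.2.2⟫_ℝ : ℝ) : ℂ)) * φ p

/-- The mode is a character of the observation space, with frequency `(ω, -ωq, -δωq)/2π`. Decay in
`q` is thus inherited from the Schwartz decay of the transformed test function. -/
theorem modeTransform_eq (δ : ℝ) (φ : 𝓢(ObsSpace, ℂ)) (ω : ℝ) (q : Plane) :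
    modeTransform δ φ ω q = obsFourier φ (obsFreq δ ω q) := by
  have e : obsFourier φ (obsFreq δ ω q) =
      FourierTransform.fourier (fun x => φ (obsEquiv x)) (obsFreq δ ω q) := rfl
  rw [e, Real.fourier_eq', modeTransform, ← measurePreserving_obsEquiv.integral_comp
    obsEquiv.toHomeomorph.measurableEmbedding]
  refine integral_congr_ae (ae_of_all _ fun x => ?_)
  simp only [smul_eq_mul]
  congr 2
  have : ⟪x, obsFreq δ ω q⟫_ℝ = (ω / (2 * Real.pi)) *
      ((obsEquiv x).1 - ⟪q, (obsEquiv x).2.1⟫_ℝ - δ * ⟪q, (obsEquiv x).2.2⟫_ℝ) := by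
    simp only [WithLp.prod_inner_apply, obsFreq, obsEquiv]
    simp [inner_smul_right, real_inner_comm]
    ring
  rw [this]
  have : (Real.pi : ℂ) ≠ 0 := by exact_mod_cast Real.pi_ne_zero
  push_cast
  field_simp

/-- Only the `y` component of the frequency is kept, so the lower bound is uniform in `δ`, including
`δ = 0`. -/
theorem le_norm_obsFreq (δ ω : ℝ) (q : Plane) :
    |ω| * ‖q‖ / (2 * Real.pi) ≤ ‖obsFreq δ ω q‖ := by
  have h1 : ‖(obsFreq δ ω q).snd.fst‖ ≤ ‖obsFreq δ ω q‖ :=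
    (WithLp.norm_fst_le _ _).trans (WithLp.norm_snd_le _ _)
  refine le_trans (le_of_eq ?_) h1
  simp [obsFreq, obsEquiv, norm_smul, abs_of_pos Real.pi_pos]
  ring

theorem continuous_obsFreq : Continuous fun x : ℝ × ℝ × Plane => obsFreq x.1 x.2.1 x.2.2 := by
  unfold obsFreq; fun_prop

theorem continuous_modeTransform (φ : 𝓢(ObsSpace, ℂ)) :
    Continuous fun x : ℝ × ℝ × Plane => modeTransform x.1 φ x.2.1 x.2.2 := by
  simp_rw [modeTransform_eq]
  exact (obsFourier φ).continuous.comp continuous_obsFreq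

/-- `φ` has Fourier transform at most `A (1 + |ξ|)⁻⁴`. -/
def FourierDecay (φ : 𝓢(ObsSpace, ℂ)) (A : ℝ) : Prop :=
  ∀ ξ, (1 + ‖ξ‖) ^ 4 * ‖obsFourier φ ξ‖ ≤ A

theorem FourierDecay.nonneg {φ : 𝓢(ObsSpace, ℂ)} {A : ℝ} (h : FourierDecay φ A) : 0 ≤ A :=
  le_trans (by positivity) (h 0)

theorem fourierDecay_seminorm (φ : 𝓢(ObsSpace, ℂ)) :
    FourierDecay φ
      (2 ^ 4 * ((Finset.Iic (4, 0)).sup (schwartzSeminormFamily ℂ EuclideanObs ℂ)) (obsFourier φ)) :=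
  fun ξ => one_add_norm_pow_mul_le 4 (obsFourier φ) ξ

theorem FourierDecay.norm_modeTransform_le {φ : 𝓢(ObsSpace, ℂ)} {A : ℝ} (h : FourierDecay φ A)
    (δ ω : ℝ) (q : Plane) :
    ‖modeTransform δ φ ω q‖ ≤ A * (1 + |ω| * ‖q‖ / (2 * Real.pi)) ^ (-4 : ℝ) := by
  have h1 := h (obsFreq δ ω q)
  have h2 := le_norm_obsFreq δ ω q
  have h0 : (0 : ℝ) < 1 + |ω| * ‖q‖ / (2 * Real.pi) := by positivity
  rw [modeTransform_eq, Real.rpow_neg h0.le, ← div_eq_mul_inv, le_div_iff₀ (by positivity),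
    mul_comm, show (4 : ℝ) = (4 : ℕ) by norm_num, Real.rpow_natCast]
  refine le_trans ?_ h1
  gcongr

/-- A linear functional controlled by the weighted sup norm of the Fourier transform. -/
noncomputable def functionalOfFourierDecay (T : 𝓢(ObsSpace, ℂ) →ₗ[ℂ] ℂ)
    (hT : ∃ C, ∀ φ A, FourierDecay φ A → ‖T φ‖ ≤ C * A) : TemperedDist where
  toLinearMap := T
  cont := by
    obtain ⟨C, hC⟩ := hT
    let p : Seminorm ℂ 𝓢(EuclideanObs, ℂ) :=
      (Finset.Iic (4, 0)).sup (schwartzSeminormFamily ℂ EuclideanObs ℂ)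
    have hp : Continuous p :=
      (schwartz_withSeminorms ℂ EuclideanObs ℂ).finset_sups.continuous_seminorm (Finset.Iic (4, 0))
    refine continuous_of_continuousAt_zero T ?_
    have hlim : Tendsto (fun φ => C * (2 ^ 4 * p (obsFourier φ))) (𝓝 0) (𝓝 0) := by
      have : Continuous fun φ => C * (2 ^ 4 * p (obsFourier φ)) :=
        continuous_const.mul (continuous_const.mul (hp.comp obsFourier.continuous))
      simpa using this.tendsto 0
    rw [ContinuousAt, map_zero]
    exact squeeze_zero_norm (fun φ => hC φ _ (fourierDecay_seminorm φ)) hlim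

/-- Convergence in probability against every test function implies convergence in probability for
the strong topology, given a uniform bound by the weighted sup norm of the Fourier transform. -/
theorem tendstoInProbability_of_forall {Ω : Type*} [MeasurableSpace Ω] (P : Measure Ω)
    {Uε : ℝ → Ω → TemperedDist} {U : TemperedDist} {C : ℝ}
    (hUε : ∀ ε > 0, ∀ w φ A, FourierDecay φ A → ‖Uε ε w φ‖ ≤ C * A)
    (hU : ∀ φ A, FourierDecay φ A → ‖U φ‖ ≤ C * A)
    (hlim : ∀ φ, ∀ r > 0, Tendsto (fun ε => P {w | r ≤ ‖Uε ε w φ - U φ‖}) (𝓝[>] 0) (𝓝 0)) :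
    TendstoInProbability P Uε U := by
  intro N hN
  have hN' : (fun T : TemperedDist => U + T) ⁻¹' N ∈ 𝓝 (0 : TemperedDist) := by
    refine (continuous_const.add continuous_id).continuousAt.preimage_mem_nhds ?_
    simpa using hN
  -- A basic neighbourhood of zero in the strong dual consists of the functionals that map a bounded
  -- set `B` into a ball of radius `r`.
  obtain ⟨⟨B, r⟩, ⟨hB, hr⟩, hBr⟩ :=
    (ContinuousLinearMap.hasBasis_nhds_zero_of_basis Metric.nhds_basis_ball).mem_iff.1 hN'
  simp only at hB hr hBr
  have hB' : Bornology.IsVonNBounded ℂ (obsFourier '' B) := hB.image obsFourier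
  -- Replacing a test function by its net point costs at most `r/4` for each of the two
  -- distributions, leaving `r/2` for the net. The form `|C| + 1` avoids any sign condition on `C`.
  set a : ℝ := r / (4 * (|C| + 1)) with ha
  have ha0 : 0 < a := by positivity
  obtain ⟨T', hT', hTf', happ⟩ := exists_finite_approx_of_isVonNBounded hB' 4 ha0
  obtain ⟨T, hTB, hTf, rfl⟩ :=
    (Set.exists_subset_image_finite_and (f := obsFourier) (s := B) (p := fun u => u = T')).1
      ⟨T', hT', hTf', rfl⟩
  have hsub : ∀ ε > 0, {w | Uε ε w ∉ N} ⊆ ⋃ φ ∈ hTf.toFinset, {w | r / 2 ≤ ‖Uε ε w φ - U φ‖} := by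
    intro ε hε w hw
    by_contra hcon
    simp only [Set.mem_iUnion, Set.mem_ofPred_eq, not_exists, not_le, Set.Finite.mem_toFinset] at hcon
    refine hw ?_
    have : Uε ε w - U ∈ (fun T : TemperedDist => U + T) ⁻¹' N := by
      refine hBr fun φ hφ => ?_
      obtain ⟨_, ⟨φ', hφ', rfl⟩, hd⟩ := happ _ ⟨φ, hφ, rfl⟩
      have hdec : FourierDecay (φ - φ') a := fun ξ => by rw [map_sub]; exact hd ξ
      have h1 := hUε ε hε w _ _ hdec
      have h2 := hU _ _ hdec
      have h3 := hcon φ' hφ'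
      have h4 : C * a ≤ r / 4 := by
        calc C * a ≤ (|C| + 1) * a := by gcongr; linarith [le_abs_self C]
          _ = r / 4 := by rw [ha]; field_simp
      rw [mem_ball_zero_iff, sub_apply]
      have e : Uε ε w φ - U φ = Uε ε w (φ - φ') - U (φ - φ') + (Uε ε w φ' - U φ') := by
        simp only [map_sub]; ring
      rw [e]
      have h5 := norm_add_le (Uε ε w (φ - φ') - U (φ - φ')) (Uε ε w φ' - U φ')
      have h6 := norm_sub_le (Uε ε w (φ - φ')) (U (φ - φ'))
      linarith
    simpa using this
  have hsum : Tendsto (fun ε => ∑ φ ∈ hTf.toFinset, P {w | r / 2 ≤ ‖Uε ε w φ - U φ‖})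
      (𝓝[>] 0) (𝓝 0) := by
    simpa using tendsto_finsetSum hTf.toFinset fun φ _ => hlim φ (r / 2) (by positivity)
  refine tendsto_of_tendsto_of_tendsto_of_le_of_le' tendsto_const_nhds hsum
    (Eventually.of_forall fun _ => zero_le) ?_
  filter_upwards [self_mem_nhdsWithin] with ε hε
  exact (measure_mono (hsub ε hε)).trans (measure_biUnion_finset_le _ _)

/-! ### Covariance inequality -/

section Covariance

variable {Ω : Type*} [MeasurableSpace Ω] {P : Measure Ω} [IsProbabilityMeasure P]

/-- `X` and `Y` are `κ`-nearly independent on events. -/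
def NearlyIndep (P : Measure Ω) (X Y : Ω → ℝ) (κ : ℝ) : Prop :=
  ∀ A B : Set ℝ, MeasurableSet A → MeasurableSet B →
    |P.real (X ⁻¹' A ∩ Y ⁻¹' B) - P.real (X ⁻¹' A) * P.real (Y ⁻¹' B)| ≤ κ

theorem setIntegral_indicator_Iic {u : ℝ} (h0 : 0 ≤ u) (h1 : u ≤ 1) :
    ∫ t in Set.Ioc (0 : ℝ) 1, (Set.Iic u).indicator (fun _ => (1 : ℝ)) t = u := by
  rw [setIntegral_indicator measurableSet_Iic, setIntegral_const, smul_eq_mul, mul_one,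
    Set.Ioc_inter_Iic, min_eq_right h1, Measure.real, Real.volume_Ioc, ENNReal.toReal_ofReal
    (by linarith), sub_zero]

theorem measurable_indicator_Iic {X : Ω → ℝ} (hX : Measurable X) :
    Measurable fun p : Ω × ℝ => (Set.Iic (X p.1)).indicator (fun _ => (1 : ℝ)) p.2 := by
  have : (fun p : Ω × ℝ => (Set.Iic (X p.1)).indicator (fun _ => (1 : ℝ)) p.2) =
      {p : Ω × ℝ | p.2 ≤ X p.1}.indicator fun _ => 1 := by
    ext p; simp [Set.indicator]
  rw [this]
  exact measurable_const.indicator (measurableSet_le measurable_snd (hX.comp measurable_fst))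

/-- Hoeffding's formula: writing `X = ∫₀¹ 1{t ≤ X} dt`, and likewise `Y`, Fubini expresses the
covariance as the integral over the unit square of covariances of the events `{t ≤ X}` and `{t' ≤
Y}`. Each of these is at most `κ`. -/
theorem abs_covariance_le_of_mem_Icc {X Y : Ω → ℝ} {κ : ℝ} (hX : Measurable X) (hY : Measurable Y)
    (h : NearlyIndep P X Y κ) (hX01 : ∀ w, X w ∈ Set.Icc (0 : ℝ) 1)
    (hY01 : ∀ w, Y w ∈ Set.Icc (0 : ℝ) 1) :
    |∫ w, X w * Y w ∂P - (∫ w, X w ∂P) * ∫ w, Y w ∂P| ≤ κ := by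
  set μ : Measure ℝ := volume.restrict (Set.Ioc 0 1) with hμ
  have : IsProbabilityMeasure μ := ⟨by simp [hμ]⟩
  let I : Ω → (Ω → ℝ) → ℝ → ℝ := fun w Z t => (Set.Iic (Z w)).indicator (fun _ => (1 : ℝ)) t
  have hI : ∀ w Z t, ‖I w Z t‖ ≤ 1 := fun w Z t => by
    by_cases h : t ≤ Z w <;> simp [I, Set.indicator, h]
  have hIm : ∀ Z : Ω → ℝ, Measurable Z → Measurable fun p : Ω × ℝ => I p.1 Z p.2 :=
    fun Z hZ => measurable_indicator_Iic hZ
  have hint : ∀ (Z : Ω → ℝ) (t : ℝ), Measurable Z → ∫ w, I w Z t ∂P = P.real (Z ⁻¹' Set.Ici t) := by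
    intro Z t hZ
    rw [← integral_indicator_one (hZ measurableSet_Ici)]
    rfl
  have hmean : ∀ Z : Ω → ℝ, Measurable Z → (∀ w, Z w ∈ Set.Icc (0 : ℝ) 1) →
      ∫ w, Z w ∂P = ∫ t, P.real (Z ⁻¹' Set.Ici t) ∂μ := by
    intro Z hZ hZ01
    calc ∫ w, Z w ∂P = ∫ w, ∫ t, I w Z t ∂μ ∂P :=
          integral_congr_ae (ae_of_all _ fun w =>
            (setIntegral_indicator_Iic (hZ01 w).1 (hZ01 w).2).symm)
      _ = ∫ t, ∫ w, I w Z t ∂P ∂μ := by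
          refine integral_integral_swap (f := fun w t => I w Z t) ?_
          exact Integrable.of_bound (hIm Z hZ).aestronglyMeasurable 1
            (ae_of_all _ fun p => hI p.1 Z p.2)
      _ = _ := by simp_rw [hint Z _ hZ]
  have hprod : ∫ w, X w * Y w ∂P =
      ∫ p : ℝ × ℝ, P.real (X ⁻¹' Set.Ici p.1 ∩ Y ⁻¹' Set.Ici p.2) ∂(μ.prod μ) := by
    calc ∫ w, X w * Y w ∂P = ∫ w, ∫ p : ℝ × ℝ, I w X p.1 * I w Y p.2 ∂(μ.prod μ) ∂P := by
          refine integral_congr_ae (ae_of_all _ fun w => ?_)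
          beta_reduce
          rw [integral_prod_mul (I w X) (I w Y)]
          exact congrArg₂ _ (setIntegral_indicator_Iic (hX01 w).1 (hX01 w).2).symm
            (setIntegral_indicator_Iic (hY01 w).1 (hY01 w).2).symm
      _ = ∫ p : ℝ × ℝ, ∫ w, I w X p.1 * I w Y p.2 ∂P ∂(μ.prod μ) := by
          refine integral_integral_swap (f := fun w (p : ℝ × ℝ) => I w X p.1 * I w Y p.2) ?_
          refine Integrable.of_bound (Measurable.aestronglyMeasurable ?_) 1
            (ae_of_all _ fun p => ?_)
          · exact ((hIm X hX).comp (measurable_fst.prodMk measurable_snd.fst)).mul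
              ((hIm Y hY).comp (measurable_fst.prodMk measurable_snd.snd))
          · rw [Function.uncurry_apply_pair, norm_mul]
            exact mul_le_one₀ (hI _ _ _) (norm_nonneg _) (hI _ _ _)
      _ = _ := by
          refine integral_congr_ae (ae_of_all _ fun p => ?_)
          beta_reduce
          rw [← integral_indicator_one ((hX measurableSet_Ici).inter (hY measurableSet_Ici))]
          refine integral_congr_ae (ae_of_all _ fun w => ?_)
          by_cases h1 : p.1 ≤ X w <;> by_cases h2 : p.2 ≤ Y w <;>
            simp [I, Set.indicator, h1, h2]
  have hm1 : Measurable fun p : ℝ × ℝ => P.real (X ⁻¹' Set.Ici p.1 ∩ Y ⁻¹' Set.Ici p.2) := by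
    refine (measurable_measure_prodMk_left (ν := P)
      (s := {q : (ℝ × ℝ) × Ω | q.1.1 ≤ X q.2 ∧ q.1.2 ≤ Y q.2}) ?_).ennreal_toReal
    exact (measurableSet_le measurable_fst.fst (hX.comp measurable_snd)).inter
      (measurableSet_le measurable_fst.snd (hY.comp measurable_snd))
  have hm2 : ∀ Z : Ω → ℝ, Measurable Z → Measurable fun t : ℝ => P.real (Z ⁻¹' Set.Ici t) := by
    intro Z hZ
    exact (measurable_measure_prodMk_left (ν := P) (s := {q : ℝ × Ω | q.1 ≤ Z q.2})
      (measurableSet_le measurable_fst (hZ.comp measurable_snd))).ennreal_toReal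
  rw [hmean X hX hX01, hmean Y hY hY01, ← integral_prod_mul, hprod, ← integral_sub]
  · have := norm_integral_le_of_norm_le_const (μ := μ.prod μ) (C := κ)
      (f := fun p => P.real (X ⁻¹' Set.Ici p.1 ∩ Y ⁻¹' Set.Ici p.2) -
        P.real (X ⁻¹' Set.Ici p.1) * P.real (Y ⁻¹' Set.Ici p.2)) (ae_of_all _ fun p : ℝ × ℝ =>
        h (Set.Ici p.1) (Set.Ici p.2) measurableSet_Ici measurableSet_Ici)
    rwa [probReal_univ, mul_one] at this
  · exact Integrable.of_bound hm1.aestronglyMeasurable 1 (ae_of_all _ fun p => by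
      rw [Real.norm_of_nonneg measureReal_nonneg]; exact measureReal_le_one)
  · refine Integrable.of_bound (((hm2 X hX).comp measurable_fst).mul
      ((hm2 Y hY).comp measurable_snd)).aestronglyMeasurable 1 (ae_of_all _ fun p => ?_)
    rw [norm_mul, Real.norm_of_nonneg measureReal_nonneg, Real.norm_of_nonneg measureReal_nonneg]
    exact mul_le_one₀ measureReal_le_one measureReal_nonneg measureReal_le_one

theorem NearlyIndep.comp {Ω : Type*} [MeasurableSpace Ω] {P : Measure Ω} {X Y : Ω → ℝ} {κ : ℝ} (h : NearlyIndep P X Y κ) {f g : ℝ → ℝ}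
    (hf : Measurable f) (hg : Measurable g) :
    NearlyIndep P (fun w => f (X w)) (fun w => g (Y w)) κ :=
  fun _ _ hA hB => h _ _ (hf hA) (hg hB)

/-- The map `x ↦ (x + 1)/2` reduces to values in `[0, 1]` and divides the covariance by four. -/
theorem abs_covariance_le {X Y : Ω → ℝ} {κ : ℝ} (hX : Measurable X) (hY : Measurable Y)
    (h : NearlyIndep P X Y κ) (hX1 : ∀ w, |X w| ≤ 1) (hY1 : ∀ w, |Y w| ≤ 1) :
    |∫ w, X w * Y w ∂P - (∫ w, X w ∂P) * ∫ w, Y w ∂P| ≤ 4 * κ := by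
  have hX' : Measurable fun w => (X w + 1) / 2 := by fun_prop
  have hY' : Measurable fun w => (Y w + 1) / 2 := by fun_prop
  have key := abs_covariance_le_of_mem_Icc hX' hY'
    (h.comp (f := fun x => (x + 1) / 2) (g := fun x => (x + 1) / 2) (by fun_prop) (by fun_prop))
    (fun w => ⟨by linarith [(abs_le.1 (hX1 w)).1], by linarith [(abs_le.1 (hX1 w)).2]⟩)
    (fun w => ⟨by linarith [(abs_le.1 (hY1 w)).1], by linarith [(abs_le.1 (hY1 w)).2]⟩)
  have iX : Integrable X P := Integrable.of_bound hX.aestronglyMeasurable 1 (ae_of_all _ hX1)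
  have iY : Integrable Y P := Integrable.of_bound hY.aestronglyMeasurable 1 (ae_of_all _ hY1)
  have iXY : Integrable (fun w => X w * Y w) P :=
    Integrable.of_bound (hX.mul hY).aestronglyMeasurable 1 (ae_of_all _ fun w => by
      rw [norm_mul]; exact mul_le_one₀ (hX1 w) (norm_nonneg _) (hY1 w))
  have mean : ∀ Z : Ω → ℝ, Integrable Z P → ∫ w, (Z w + 1) / 2 ∂P = ((∫ w, Z w ∂P) + 1) / 2 := by
    intro Z hZ
    rw [integral_div, integral_add hZ (integrable_const _)]
    simp
  have e : ∫ w, (X w + 1) / 2 * ((Y w + 1) / 2) ∂P =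
      ((∫ w, X w * Y w ∂P) + (∫ w, X w ∂P) + (∫ w, Y w ∂P) + 1) / 4 := by
    have : ∀ w, (X w + 1) / 2 * ((Y w + 1) / 2) = (X w * Y w + X w + Y w + 1) / 4 := fun w => by
      ring
    simp_rw [this]
    have i2 : Integrable (fun w => X w * Y w + X w) P := iXY.add iX
    have i3 : Integrable (fun w => X w * Y w + X w + Y w) P := i2.add iY
    rw [integral_div, integral_add i3 (integrable_const _), integral_add i2 iY,
      integral_add iXY iX]
    simp
  rw [e, mean X iX, mean Y iY] at key
  have e2 : ∫ w, X w * Y w ∂P - (∫ w, X w ∂P) * ∫ w, Y w ∂P =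
      4 * (((∫ w, X w * Y w ∂P) + (∫ w, X w ∂P) + (∫ w, Y w ∂P) + 1) / 4 -
        ((∫ w, X w ∂P) + 1) / 2 * (((∫ w, Y w ∂P) + 1) / 2)) := by ring
  rw [e2, abs_mul, abs_of_pos (by norm_num : (0 : ℝ) < 4)]
  gcongr

open ComplexConjugate in
/-- Covariance of `exp(iX)` and `exp(iY)`. -/
theorem norm_covariance_exp_le {X Y : Ω → ℝ} {κ : ℝ} (hX : Measurable X) (hY : Measurable Y)
    (h : NearlyIndep P X Y κ) :
    ‖∫ w, Complex.exp (X w * Complex.I) * conj (Complex.exp (Y w * Complex.I)) ∂P -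
      (∫ w, Complex.exp (X w * Complex.I) ∂P) * conj (∫ w, Complex.exp (Y w * Complex.I) ∂P)‖
      ≤ 16 * κ := by
  have bd : ∀ (f : ℝ → ℝ), Measurable f → (∀ x, |f x| ≤ 1) → ∀ Z : Ω → ℝ, Measurable Z →
      Integrable (fun w => f (Z w)) P := fun f hf hf1 Z hZ =>
    Integrable.of_bound (hf.comp hZ).aestronglyMeasurable 1 (ae_of_all _ fun w => hf1 _)
  have bd2 : ∀ (f g : ℝ → ℝ), Measurable f → Measurable g → (∀ x, |f x| ≤ 1) → (∀ x, |g x| ≤ 1) →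
      Integrable (fun w => f (X w) * g (Y w)) P := fun f g hf hg hf1 hg1 =>
    Integrable.of_bound ((hf.comp hX).mul (hg.comp hY)).aestronglyMeasurable 1
      (ae_of_all _ fun w => by
        rw [norm_mul]; exact mul_le_one₀ (hf1 _) (norm_nonneg _) (hg1 _))
  have cov : ∀ (f g : ℝ → ℝ), Measurable f → Measurable g → (∀ x, |f x| ≤ 1) → (∀ x, |g x| ≤ 1) →
      |∫ w, f (X w) * g (Y w) ∂P - (∫ w, f (X w) ∂P) * ∫ w, g (Y w) ∂P| ≤ 4 * κ :=
    fun f g hf hg hf1 hg1 => abs_covariance_le (hf.comp hX) (hg.comp hY) (h.comp hf hg)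
      (fun w => hf1 _) (fun w => hg1 _)
  have mc := Real.measurable_cos
  have ms := Real.measurable_sin
  have c1 := Real.abs_cos_le_one
  have s1 := Real.abs_sin_le_one
  have mean : ∀ Z : Ω → ℝ, Measurable Z → ∫ w, Complex.exp (Z w * Complex.I) ∂P =
      ((∫ w, Real.cos (Z w) ∂P : ℝ) : ℂ) + ((∫ w, Real.sin (Z w) ∂P : ℝ) : ℂ) * Complex.I := by
    intro Z hZ
    simp_rw [Complex.exp_mul_I, ← Complex.ofReal_cos, ← Complex.ofReal_sin]
    rw [integral_add (bd _ mc c1 Z hZ).ofReal ((bd _ ms s1 Z hZ).ofReal.mul_const _),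
      integral_mul_const, integral_complex_ofReal, integral_complex_ofReal]
  have corr : ∫ w, Complex.exp (X w * Complex.I) * conj (Complex.exp (Y w * Complex.I)) ∂P =
      ((∫ w, Real.cos (X w) * Real.cos (Y w) ∂P : ℝ) : ℂ) +
      ((∫ w, Real.sin (X w) * Real.sin (Y w) ∂P : ℝ) : ℂ) +
      (((∫ w, Real.sin (X w) * Real.cos (Y w) ∂P : ℝ) : ℂ) -
      ((∫ w, Real.cos (X w) * Real.sin (Y w) ∂P : ℝ) : ℂ)) * Complex.I := by
    have : ∀ w, Complex.exp (X w * Complex.I) * conj (Complex.exp (Y w * Complex.I)) =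
        ((Real.cos (X w) * Real.cos (Y w) : ℝ) : ℂ) + ((Real.sin (X w) * Real.sin (Y w) : ℝ) : ℂ) +
        (((Real.sin (X w) * Real.cos (Y w) : ℝ) : ℂ) -
          ((Real.cos (X w) * Real.sin (Y w) : ℝ) : ℂ)) * Complex.I := by
      intro w
      simp only [Complex.exp_mul_I, ← Complex.ofReal_cos, ← Complex.ofReal_sin, map_add, map_mul,
        Complex.conj_ofReal, Complex.conj_I]
      push_cast
      linear_combination (-Complex.sin (X w) * Complex.sin (Y w)) * Complex.I_sq
    simp_rw [this]
    have icc := (bd2 _ _ mc mc c1 c1).ofReal (𝕜 := ℂ)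
    have iss := (bd2 _ _ ms ms s1 s1).ofReal (𝕜 := ℂ)
    have isc := (bd2 _ _ ms mc s1 c1).ofReal (𝕜 := ℂ)
    have ics := (bd2 _ _ mc ms c1 s1).ofReal (𝕜 := ℂ)
    have e1 := integral_add (icc.add iss) ((isc.sub ics).mul_const Complex.I)
    have e2 := integral_add icc iss
    have e3 := integral_sub isc ics
    simp only [Pi.add_apply, Pi.sub_apply] at e1
    refine e1.trans ?_
    rw [integral_mul_const]
    refine congrArg₂ _ (e2.trans ?_) (congrArg (· * Complex.I) (e3.trans ?_))
    · exact congrArg₂ _ integral_complex_ofReal integral_complex_ofReal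
    · exact congrArg₂ _ integral_complex_ofReal integral_complex_ofReal
  rw [corr, mean X hX, mean Y hY]
  have k1 := cov _ _ mc mc c1 c1
  have k2 := cov _ _ ms ms s1 s1
  have k3 := cov _ _ ms mc s1 c1
  have k4 := cov _ _ mc ms c1 s1
  generalize (∫ w, Real.cos (X w) * Real.cos (Y w) ∂P) = cc at *
  generalize (∫ w, Real.sin (X w) * Real.sin (Y w) ∂P) = ss at *
  generalize (∫ w, Real.sin (X w) * Real.cos (Y w) ∂P) = sc at *
  generalize (∫ w, Real.cos (X w) * Real.sin (Y w) ∂P) = cs at *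
  generalize (∫ w, Real.cos (X w) ∂P) = c at *
  generalize (∫ w, Real.sin (X w) ∂P) = s at *
  generalize (∫ w, Real.cos (Y w) ∂P) = c' at *
  generalize (∫ w, Real.sin (Y w) ∂P) = s' at *
  -- The real and imaginary parts each combine two covariances of sines and cosines. Four terms of
  -- size `4κ` give the constant 16.
  have e : ((cc : ℂ) + ss + (sc - cs) * Complex.I -
      (c + s * Complex.I) * conj ((c' : ℂ) + s' * Complex.I)) =
      ((cc - c * c' + (ss - s * s') : ℝ) : ℂ) +
        ((sc - s * c' - (cs - c * s') : ℝ) : ℂ) * Complex.I := by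
    simp only [map_add, map_mul, Complex.conj_ofReal, Complex.conj_I]
    push_cast
    linear_combination ((s : ℂ) * s') * Complex.I_sq
  rw [e]
  refine (norm_add_le _ _).trans ?_
  rw [norm_mul, Complex.norm_I, mul_one, Complex.norm_real, Complex.norm_real, Real.norm_eq_abs,
    Real.norm_eq_abs]
  have := abs_add_le (cc - c * c') (ss - s * s')
  have := abs_sub (sc - s * c') (cs - c * s')
  linarith

end Covariance

/-! ### Averaging of an oscillating mixing field -/

section Averaging

open ComplexConjugate

variable {Ω : Type*} [MeasurableSpace Ω] {P : Measure Ω} [IsProbabilityMeasure P]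
  {V : Ω → Plane → ℝ}

theorem IsMixingField.measurable_uncurry {Ω : Type*} [MeasurableSpace Ω] {P : Measure Ω}
    {V : Ω → Plane → ℝ} (hV : IsMixingField P V) :
    Measurable fun p : Ω × Plane => V p.1 p.2 :=
  (measurable_uncurry_of_continuous_of_measurable (u := fun x w => V w x)
    (fun w => hV.continuous w) hV.measurable).comp measurable_swap

/-- Mixing is only used through one-point sets `S = {x}`, `S' = {y}`. -/
theorem nearlyIndep_of_lt_dist (V : Ω → Plane → ℝ) {r : ℝ} {x y : Plane} (h : r < dist x y) :
    NearlyIndep P (fun w => V w x) (fun w => V w y) (alphaMixing P V r) := by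
  intro A B hA hB
  -- The supremum is a real one, so boundedness of the set has to be supplied; differences of
  -- probabilities are at most 1.
  refine le_csSup ⟨1, ?_⟩ ⟨{x}, {y}, Set.singleton_nonempty _, Set.singleton_nonempty _, ?_,
    _, _, ?_, ?_, rfl⟩
  · rintro _ ⟨_, _, _, _, _, A, B, _, _, rfl⟩
    rw [abs_le]
    have h1 : P.real (A ∩ B) ≤ 1 := measureReal_le_one
    have h2 : P.real A * P.real B ≤ 1 :=
      mul_le_one₀ measureReal_le_one measureReal_nonneg measureReal_le_one
    have h3 : 0 ≤ P.real (A ∩ B) := measureReal_nonneg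
    have h4 : 0 ≤ P.real A * P.real B := mul_nonneg measureReal_nonneg measureReal_nonneg
    constructor <;> linarith
  · simpa [setDist] using h
  · exact le_iSup₂ (f := fun z (_ : z ∈ ({x} : Set Plane)) =>
      MeasurableSpace.comap (fun w => V w z) inferInstance) x rfl _ ⟨A, hA, rfl⟩
  · exact le_iSup₂ (f := fun z (_ : z ∈ ({y} : Set Plane)) =>
      MeasurableSpace.comap (fun w => V w z) inferInstance) y rfl _ ⟨B, hB, rfl⟩

/-- Evaluating the laws of the field and of its translate by `x` at the origin compares `V(x)` with
`V(0)`. -/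
theorem IsMixingField.integral_exp {Ω : Type*} [MeasurableSpace Ω] {P : Measure Ω}
    {V : Ω → Plane → ℝ} (hV : IsMixingField P V) (u : ℝ) (x : Plane) :
    ∫ w, Complex.exp (((u * V w x : ℝ) : ℂ) * Complex.I) ∂P = elevationCharFun P V u := by
  have hm : Measurable fun (w : Ω) (y : Plane) => V w y := measurable_pi_lambda _ hV.measurable
  have hm' : Measurable fun (w : Ω) (y : Plane) => V w (y + x) :=
    measurable_pi_lambda _ fun y => hV.measurable _
  have hg : Measurable fun v : Plane → ℝ => Complex.exp (((u * v 0 : ℝ) : ℂ) * Complex.I) := by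
    fun_prop
  have h := congrArg (fun μ => ∫ v : Plane → ℝ, Complex.exp (((u * v 0 : ℝ) : ℂ) * Complex.I) ∂μ)
    (hV.stationary x)
  beta_reduce at h
  rw [integral_map hm'.aemeasurable hg.aestronglyMeasurable,
    integral_map hm.aemeasurable hg.aestronglyMeasurable] at h
  simp only [zero_add] at h
  rw [h, elevationCharFun]
  congr with w
  push_cast
  ring_nf

theorem norm_elevationCharFun_le (V : Ω → Plane → ℝ) (u : ℝ) : ‖elevationCharFun P V u‖ ≤ 1 := by
  refine (norm_integral_le_of_norm_le_const (C := 1) (ae_of_all _ fun w => ?_)).trans (by simp)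
  rw [Complex.norm_exp]
  simp

theorem IsMixingField.continuous_elevationCharFun (hV : IsMixingField P V) :
    Continuous (elevationCharFun P V) := by
  have h0 := hV.measurable 0
  refine continuous_of_dominated (bound := fun _ => 1) (fun u => ?_) (fun u => ?_)
    (integrable_const _) (ae_of_all _ fun w => by fun_prop)
  · exact Measurable.aestronglyMeasurable (by fun_prop)
  · refine ae_of_all _ fun w => ?_
    rw [Complex.norm_exp]
    simp

/-- The centred phase `exp(i u V(x)) - φ_V(u)`. -/
noncomputable def centredPhase (P : Measure Ω) (V : Ω → Plane → ℝ) (u : ℝ) (w : Ω) (x : Plane) :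
    ℂ :=
  Complex.exp (((u * V w x : ℝ) : ℂ) * Complex.I) - elevationCharFun P V u

theorem norm_centredPhase_le (V : Ω → Plane → ℝ) (u : ℝ) (w : Ω) (x : Plane) :
    ‖centredPhase P V u w x‖ ≤ 2 := by
  refine (norm_sub_le _ _).trans ?_
  rw [Complex.norm_exp_ofReal_mul_I]
  linarith [norm_elevationCharFun_le (P := P) V u]

theorem IsMixingField.measurable_centredPhase {Ω : Type*} [MeasurableSpace Ω] {P : Measure Ω}
    {V : Ω → Plane → ℝ} (hV : IsMixingField P V) (u : ℝ) :
    Measurable fun p : Ω × Plane => centredPhase P V u p.1 p.2 := by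
  have := hV.measurable_uncurry
  unfold centredPhase
  fun_prop

/-- The covariance of the phases at two points. -/
noncomputable def phaseCovariance (P : Measure Ω) (V : Ω → Plane → ℝ) (u : ℝ) (x y : Plane) : ℂ :=
  ∫ w, centredPhase P V u w x * conj (centredPhase P V u w y) ∂P

theorem norm_phaseCovariance_le (V : Ω → Plane → ℝ) (u : ℝ) (x y : Plane) :
    ‖phaseCovariance P V u x y‖ ≤ 4 := by
  refine (norm_integral_le_of_norm_le_const (C := 4) (ae_of_all _ fun w => ?_)).trans (by simp)
  rw [norm_mul, RCLike.norm_conj]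
  nlinarith [norm_centredPhase_le (P := P) V u w x, norm_centredPhase_le (P := P) V u w y,
    norm_nonneg (centredPhase P V u w x), norm_nonneg (centredPhase P V u w y)]

theorem IsMixingField.measurable_phaseCovariance (hV : IsMixingField P V) (u : ℝ) :
    StronglyMeasurable fun p : Plane × Plane => phaseCovariance P V u p.1 p.2 := by
  have hm := hV.measurable_centredPhase u
  have h1 : Measurable fun p : (Plane × Plane) × Ω => centredPhase P V u p.2 p.1.1 *
      conj (centredPhase P V u p.2 p.1.2) :=
    (hm.comp (measurable_snd.prodMk measurable_fst.fst)).mul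
      (Complex.continuous_conj.measurable.comp
        (hm.comp (measurable_snd.prodMk measurable_fst.snd)))
  exact h1.stronglyMeasurable.integral_prod_right'

/-- By stationarity both phases have mean `φ_V(u)`, so the centred correlation is the covariance of
two unit exponentials of nearly independent variables. -/
theorem IsMixingField.norm_phaseCovariance_le_alphaMixing (hV : IsMixingField P V) (u : ℝ) {r : ℝ}
    {x y : Plane} (h : r < dist x y) :
    ‖phaseCovariance P V u x y‖ ≤ 16 * alphaMixing P V r := by
  set E : Plane → Ω → ℂ := fun z w => Complex.exp (((u * V w z : ℝ) : ℂ) * Complex.I) with hE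
  have hi : ∀ z, Integrable (E z) P := by
    intro z
    have := hV.measurable z
    exact Integrable.of_bound (Measurable.aestronglyMeasurable (by fun_prop)) 1
      (ae_of_all _ fun w => (Complex.norm_exp_ofReal_mul_I _).le)
  have hic : ∀ z, Integrable (fun w => conj (E z w)) P :=
    fun z => (LinearIsometryEquiv.integrable_comp_iff (RCLike.conjLIE (K := ℂ))).2 (hi z)
  have hxy : Integrable (fun w => E x w * conj (E y w)) P :=
    Integrable.bdd_mul (hic y) (hi x).1 (ae_of_all _ fun w => (Complex.norm_exp_ofReal_mul_I _).le)
  have key := norm_covariance_exp_le ((hV.measurable x).const_mul u) ((hV.measurable y).const_mul u)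
    ((nearlyIndep_of_lt_dist (P := P) V h).comp (f := fun t => u * t) (g := fun t => u * t)
      (by fun_prop) (by fun_prop))
  refine le_of_eq_of_le (congrArg _ ?_) key
  set φ := elevationCharFun P V u
  have hφ : ∀ z, ∫ w, E z w ∂P = φ := hV.integral_exp u
  rw [hV.integral_exp, hV.integral_exp]
  have j1 : Integrable (fun w => φ * conj (E y w)) P := (hic y).const_mul φ
  have j2 : Integrable (fun w => E x w * conj φ) P := (hi x).mul_const (conj φ)
  have j3 : Integrable (fun _ : Ω => φ * conj φ) P := integrable_const _
  have j4 : Integrable (fun w => E x w * conj (E y w) - φ * conj (E y w)) P := hxy.sub j1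
  have j5 : Integrable (fun w => E x w * conj φ - φ * conj φ) P := j2.sub j3
  -- The expansion is grouped so that the second bracket has zero expectation.
  calc phaseCovariance P V u x y
      = ∫ w, (E x w * conj (E y w) - φ * conj (E y w)) - (E x w * conj φ - φ * conj φ) ∂P := by
        refine integral_congr_ae (ae_of_all _ fun w => ?_)
        simp only [centredPhase, map_sub, hE, φ]
        ring
    _ = _ := by
        rw [integral_sub j4 j5, integral_sub hxy j1, integral_sub j2 j3, integral_const_mul,
          integral_mul_const, integral_conj, hφ, hφ]
        rw [integral_const, probReal_univ, one_smul, sub_self, sub_zero]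

/-- The second moment of an average of centred phases. -/
theorem IsMixingField.integral_norm_sq_average (hV : IsMixingField P V) (u : ℝ) {h : Plane → ℂ}
    (hh : Integrable h) {f : Plane → Plane} (hf : Measurable f) :
    ((∫ w, ‖∫ η, centredPhase P V u w (f η) * h η‖ ^ 2 ∂P : ℝ) : ℂ) =
      ∫ p : Plane × Plane, (h p.1 * conj (h p.2)) *
        phaseCovariance P V u (f p.1) (f p.2) := by
  have hm := hV.measurable_centredPhase u
  calc ((∫ w, ‖∫ η, centredPhase P V u w (f η) * h η‖ ^ 2 ∂P : ℝ) : ℂ)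
      = ∫ w, (∫ p : Plane × Plane, (centredPhase P V u w (f p.1) * h p.1) *
          conj (centredPhase P V u w (f p.2) * h p.2)) ∂P := by
        rw [← integral_complex_ofReal]
        refine integral_congr_ae (ae_of_all _ fun w => ?_)
        beta_reduce
        rw [Measure.volume_eq_prod, integral_prod_mul (fun η => centredPhase P V u w (f η) * h η)
          (fun η => conj (centredPhase P V u w (f η) * h η)), integral_conj, Complex.mul_conj,
          Complex.normSq_eq_norm_sq]
    _ = ∫ p : Plane × Plane, ∫ w, (centredPhase P V u w (f p.1) * h p.1) *
          conj (centredPhase P V u w (f p.2) * h p.2) ∂P := by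
        refine integral_integral_swap (f := fun w (p : Plane × Plane) =>
          (centredPhase P V u w (f p.1) * h p.1) * conj (centredPhase P V u w (f p.2) * h p.2)) ?_
        have hhc : Integrable fun p : Plane × Plane => h p.1 * conj (h p.2) :=
          hh.mul_prod (integrable_conj_comp hh)
        have hh2 : Integrable (fun p : Ω × (Plane × Plane) => h p.2.1 * conj (h p.2.2))
            (P.prod volume) := hhc.comp_snd P
        have h1 : Measurable fun p : Ω × (Plane × Plane) => centredPhase P V u p.1 (f p.2.1) *
            conj (centredPhase P V u p.1 (f p.2.2)) :=
          (hm.comp (measurable_fst.prodMk (hf.comp measurable_snd.fst))).mul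
            (Complex.continuous_conj.measurable.comp
              (hm.comp (measurable_fst.prodMk (hf.comp measurable_snd.snd))))
        refine (hh2.bdd_mul (c := 2 * 2) h1.aestronglyMeasurable (ae_of_all _ fun p => ?_)).congr
          (ae_of_all _ fun p => ?_)
        · rw [norm_mul, RCLike.norm_conj]
          gcongr <;> exact norm_centredPhase_le _ _ _ _
        · simp only [Function.uncurry, map_mul]
          ring
    _ = _ := by
        refine integral_congr_ae (ae_of_all _ fun p => ?_)
        beta_reduce
        rw [phaseCovariance, ← integral_const_mul]
        refine integral_congr_ae (ae_of_all _ fun w => ?_)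
        simp only [map_mul]
        ring

/-- The second moment is a double integral of `h ⊗ conj h` against phase covariances at points `|b|
· |η - η'|` apart. These vanish in the limit off the diagonal, which is a null set, and are bounded
by 4. Dominated convergence gives convergence in `L²`, hence in `L¹`. -/
theorem IsMixingField.tendsto_lintegral_average (hV : IsMixingField P V) (u : ℝ) {h : Plane → ℂ}
    (hh : Integrable h) {l : Filter ℝ} [l.IsCountablyGenerated] {a : ℝ → Plane} {b : ℝ → ℝ}
    (hb : Tendsto (fun ε => |b ε|) l atTop) :
    Tendsto (fun ε => ∫⁻ w, ‖∫ η, centredPhase P V u w (a ε + b ε • η) * h η‖ₑ ∂P) l (𝓝 0) := by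
  set D : ℝ → Ω → ℂ := fun ε w => ∫ η, centredPhase P V u w (a ε + b ε • η) * h η with hD
  have hm := hV.measurable_centredPhase u
  have hDm : ∀ ε, AEStronglyMeasurable (D ε) P := by
    intro ε
    have hf : Measurable fun p : Ω × Plane => a ε + b ε • p.2 := by fun_prop
    have h0 : AEStronglyMeasurable (fun p : Ω × Plane => centredPhase P V u p.1 (a ε + b ε • p.2))
        (P.prod volume) := (hm.comp (measurable_fst.prodMk hf)).aestronglyMeasurable
    have h2 : AEStronglyMeasurable (fun p : Ω × Plane => h p.2) (P.prod volume) := hh.1.comp_snd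
    have h1 := h0.mul h2
    exact h1.integral_prod_right'
  have hDb : ∀ ε w, ‖D ε w‖ ≤ 2 * ∫ η, ‖h η‖ := by
    intro ε w
    rw [← integral_const_mul]
    refine norm_integral_le_of_norm_le (hh.norm.const_mul 2) (ae_of_all _ fun η => ?_)
    rw [norm_mul]
    gcongr
    exact norm_centredPhase_le _ _ _ _
  have hsq : Tendsto (fun ε => ∫ w, ‖D ε w‖ ^ 2 ∂P) l (𝓝 0) := by
    have hc : Tendsto (fun ε => ((∫ w, ‖D ε w‖ ^ 2 ∂P : ℝ) : ℂ)) l (𝓝 0) := by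
      have e : ∀ ε, ((∫ w, ‖D ε w‖ ^ 2 ∂P : ℝ) : ℂ) = ∫ p : Plane × Plane,
          (h p.1 * conj (h p.2)) * phaseCovariance P V u (a ε + b ε • p.1) (a ε + b ε • p.2) :=
        fun ε => hV.integral_norm_sq_average u hh (f := fun η => a ε + b ε • η) (by fun_prop)
      rw [funext e]
      have hhc : Integrable fun p : Plane × Plane => h p.1 * conj (h p.2) :=
        hh.mul_prod (integrable_conj_comp hh)
      rw [show (0 : ℂ) = ∫ p : Plane × Plane, (0 : ℂ) by simp]
      refine tendsto_integral_filter_of_dominated_convergence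
        (fun p => ‖h p.1 * conj (h p.2)‖ * 4) (Eventually.of_forall fun ε => ?_)
        (Eventually.of_forall fun ε => ae_of_all _ fun p => ?_) (hhc.norm.mul_const 4) ?_
      · refine hhc.1.mul ?_
        exact ((hV.measurable_phaseCovariance u).comp_measurable
          (g := fun p : Plane × Plane => (a ε + b ε • p.1, a ε + b ε • p.2))
          (by fun_prop)).aestronglyMeasurable
      · rw [norm_mul]
        gcongr
        exact norm_phaseCovariance_le _ _ _ _
      · have hne : ∀ᵐ p : Plane × Plane, p.1 ≠ p.2 := by
          rw [Measure.volume_eq_prod]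
          rw [ae_iff, Measure.measure_prod_null]
          · refine ae_of_all _ fun x => ?_
            have : (Prod.mk x ⁻¹' {p : Plane × Plane | ¬ p.1 ≠ p.2}) = {x} := by
              ext y; simp [eq_comm]
            beta_reduce
            rw [this]
            simp
          · simpa using measurableSet_eq_fun measurable_fst measurable_snd
        filter_upwards [hne] with p hp
        -- The mixing coefficient needs a radius strictly below the distance of the two points,
        -- hence the `- 1`.
        have hd : Tendsto (fun ε => |b ε| * dist p.1 p.2 - 1) l atTop := by
          refine tendsto_atTop_add_const_right _ _ ?_
          exact hb.atTop_mul_const (dist_pos.2 hp)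
        have hα := hV.mixing.comp hd
        rw [show (0 : ℂ) = h p.1 * conj (h p.2) * 0 by simp]
        refine tendsto_const_nhds.mul (squeeze_zero_norm (fun ε => ?_)
          (by simpa using hα.const_mul 16))
        refine hV.norm_phaseCovariance_le_alphaMixing u ?_
        have : dist (a ε + b ε • p.1) (a ε + b ε • p.2) = |b ε| * dist p.1 p.2 := by
          rw [dist_add_left, dist_smul₀, Real.norm_eq_abs]
        rw [this]
        linarith
    have := (Complex.continuous_re.tendsto 0).comp hc
    simpa [Function.comp_def] using this
  have hle : ∀ ε, ∫⁻ w, ‖D ε w‖ₑ ∂P ≤ ENNReal.ofReal √(∫ w, ‖D ε w‖ ^ 2 ∂P) := by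
    intro ε
    have hint : Integrable (D ε) P := Integrable.of_bound (hDm ε) _ (ae_of_all _ (hDb ε))
    have hint2 : MemLp (fun w => ‖D ε w‖) 2 P :=
      MemLp.of_bound (hDm ε).norm (2 * ∫ η, ‖h η‖) (ae_of_all _ fun w => by simpa using hDb ε w)
    rw [← ofReal_integral_norm_eq_lintegral_enorm hint]
    refine ENNReal.ofReal_le_ofReal (Real.le_sqrt_of_sq_le ?_)
    -- Nonnegative variance gives `(E‖D‖)² ≤ E‖D‖²`.
    have := ProbabilityTheory.variance_nonneg (fun w => ‖D ε w‖) P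
    rw [ProbabilityTheory.variance_eq_sub hint2] at this
    simpa using this
  refine tendsto_of_tendsto_of_tendsto_of_le_of_le tendsto_const_nhds ?_ (fun _ => zero_le) hle
  have := (ENNReal.continuous_ofReal.tendsto _).comp ((Real.continuous_sqrt.tendsto _).comp hsq)
  simpa [Function.comp_def] using this

end Averaging

/-! ### Source and propagators -/

theorem norm_exp_I_mul_ofReal (x : ℝ) : ‖Complex.exp (Complex.I * x)‖ = 1 := by
  rw [mul_comm, Complex.norm_exp_ofReal_mul_I]

theorem norm_sourceTransform_le (Ψ : ℝ × Plane → ℂ) (ω : ℝ) (k : Plane) :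
    ‖sourceTransform Ψ ω k‖ ≤ ∫ p, ‖Ψ p‖ := by
  refine (norm_integral_le_integral_norm _).trans (le_of_eq ?_)
  congr with p
  rw [norm_mul, mul_assoc, ← Complex.ofReal_mul, norm_exp_I_mul_ofReal, mul_one]

theorem continuous_sourceTransform {Ψ : ℝ × Plane → ℂ} (hΨ : Integrable Ψ) :
    Continuous fun p : ℝ × Plane => sourceTransform Ψ p.1 p.2 := by
  refine continuous_of_dominated (bound := fun p => ‖Ψ p‖) (fun x => ?_) (fun x => ?_) hΨ.norm
    (ae_of_all _ fun p => by fun_prop)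
  · exact hΨ.1.mul (by fun_prop : Continuous fun p : ℝ × Plane => Complex.exp
      (Complex.I * x.1 * ((p.1 - ⟪x.2, p.2⟫_ℝ : ℝ) : ℂ))).aestronglyMeasurable
  · refine ae_of_all _ fun p => ?_
    rw [norm_mul, mul_assoc, ← Complex.ofReal_mul, norm_exp_I_mul_ofReal, mul_one]

theorem IsAdmissibleSource.exists_bound {Ψ : ℝ × Plane → ℂ} (hΨ : IsAdmissibleSource Ψ) :
    ∃ R > 0, ∀ ω k, (R < |ω| ∨ R < ‖k‖) → sourceTransform Ψ ω k = 0 := by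
  obtain ⟨R, hR, h⟩ := hΨ.compactSupport.isCompact.isBounded.exists_pos_norm_le
  refine ⟨R, hR, fun ω k hk => ?_⟩
  by_contra hne
  have := h (ω, k) (subset_tsupport _ hne)
  rw [Prod.norm_def, max_le_iff] at this
  rcases hk with hk | hk
  · exact absurd this.1 (not_le.2 hk)
  · exact absurd this.2 (not_le.2 hk)

/-- The weight `(1 + a|q|)⁻⁴`. -/
noncomputable def decayWeight (a : ℝ) (q : Plane) : ℝ := (1 + a * ‖q‖) ^ (-4 : ℝ)

theorem continuous_decayWeight {a : ℝ} (ha : 0 < a) : Continuous (decayWeight a) := by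
  unfold decayWeight
  refine Continuous.rpow_const (by fun_prop) fun q => Or.inl ?_
  positivity

theorem decayWeight_nonneg {a : ℝ} (ha : 0 < a) (q : Plane) : 0 ≤ decayWeight a q := by
  unfold decayWeight; positivity

theorem decayWeight_le_one {a : ℝ} (ha : 0 < a) (q : Plane) : decayWeight a q ≤ 1 :=
  Real.rpow_le_one_of_one_le_of_nonpos (by have : 0 ≤ a * ‖q‖ := by positivity
                                           linarith) (by norm_num)

theorem decayWeight_anti {a b : ℝ} (ha : 0 < a) (hab : a ≤ b) (q : Plane) :
    decayWeight b q ≤ decayWeight a q :=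
  Real.rpow_le_rpow_of_nonpos (by positivity) (by gcongr) (by norm_num)

theorem integrable_decayWeight {a : ℝ} (ha : 0 < a) : Integrable (decayWeight a) := by
  have h : Integrable fun q : Plane => (1 + ‖q‖) ^ (-4 : ℝ) :=
    integrable_one_add_norm (by simp; norm_num)
  refine (h.comp_smul ha.ne').congr (ae_of_all _ fun q => ?_)
  simp [decayWeight, norm_smul, abs_of_pos ha]

theorem memLp_decayWeight {a : ℝ} (ha : 0 < a) : MemLp (decayWeight a) 2 := by
  refine (memLp_two_iff_integrable_sq (continuous_decayWeight ha).aestronglyMeasurable).2 ?_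
  refine (integrable_decayWeight ha).mono
    ((continuous_decayWeight ha).pow 2).aestronglyMeasurable (ae_of_all _ fun q => ?_)
  have h0 := decayWeight_nonneg ha q
  have h1 := decayWeight_le_one ha q
  rw [Real.norm_of_nonneg (by positivity), Real.norm_of_nonneg h0]
  nlinarith

namespace Setup

variable (M : Setup)

theorem norm_propagator (j : Fin 2) (ω : ℝ) (q : Plane) (z : ℝ) : ‖M.propagator j ω q z‖ = 1 := by
  rw [propagator]
  have : -Complex.I * ω * z * M.c j * ((q.ofLp ⬝ᵥ (M.A j *ᵥ q.ofLp) : ℝ) : ℂ) / 2 =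
      Complex.I * ((-(ω * z * M.c j * (q.ofLp ⬝ᵥ (M.A j *ᵥ q.ofLp)) / 2) : ℝ) : ℂ) := by
    push_cast; ring
  rw [this, norm_exp_I_mul_ofReal]

theorem continuous_propagator (j : Fin 2) (z : ℝ) :
    Continuous fun p : ℝ × Plane => M.propagator j p.1 p.2 z := by
  have : Continuous fun p : ℝ × Plane => p.2.ofLp ⬝ᵥ (M.A j *ᵥ p.2.ofLp) := by
    simp only [dotProduct, Matrix.mulVec]
    fun_prop
  unfold propagator
  fun_prop

theorem slow_radicand_pos (j : Fin 2) : 0 < 1 - M.c j ^ 2 * ‖M.k₀‖ ^ 2 := by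
  have h0 : 0 ≤ M.c j * ‖M.k₀‖ := mul_nonneg (M.c_pos j).le (norm_nonneg _)
  have h1 := M.propagating j
  nlinarith

theorem slow_pos (j : Fin 2) : 0 < M.slow j :=
  div_pos (Real.sqrt_pos.2 (M.slow_radicand_pos j)) (M.c_pos j)

theorem slow_sq (j : Fin 2) : M.c j ^ 2 * M.slow j ^ 2 = 1 - M.c j ^ 2 * ‖M.k₀‖ ^ 2 := by
  have := (M.c_pos j).ne'
  rw [slow, div_pow, Real.sq_sqrt (M.slow_radicand_pos j).le]
  field_simp

/-- The travel time of the specular ray equals its phase. -/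
theorem tObs_eq :
    M.tObs = M.slow 0 * M.zInt + M.slow 1 * (M.zTr - M.zInt) + ⟪M.xObs, M.k₀⟫_ℝ := by
  have h0 := M.slow_sq 0
  have h1 := M.slow_sq 1
  have c0 := (M.c_pos 0).ne'
  have c1 := (M.c_pos 1).ne'
  have s0 := (M.slow_pos 0).ne'
  have s1 := (M.slow_pos 1).ne'
  rw [tObs, xObs, xInt, inner_add_left, real_inner_smul_left, real_inner_smul_left,
    real_inner_self_eq_norm_sq]
  have e0 : M.zInt / (M.c 0 ^ 2 * M.slow 0) =
      M.slow 0 * M.zInt + M.zInt / M.slow 0 * ‖M.k₀‖ ^ 2 := by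
    field_simp
    linear_combination (-M.zInt) * h0
  have e1 : (M.zTr - M.zInt) / (M.c 1 ^ 2 * M.slow 1) =
      M.slow 1 * (M.zTr - M.zInt) + (M.zTr - M.zInt) / M.slow 1 * ‖M.k₀‖ ^ 2 := by
    field_simp
    linear_combination (-(M.zTr - M.zInt)) * h1
  rw [e0, e1]
  ring

/-- The observation variables follow the specular front: `t_obs` cancels the carrier phase at
`x_obs`, and the `k₀` terms in the time cancel those produced by moving the point. What remains of
the carrier is `ε s`, and `ỹ` enters with the scale ratio `ε^γ/√ε`. -/
theorem mode_obs (γ : ℝ) {ε : ℝ} (hε : 0 < ε) (ω : ℝ) (q : Plane) (p : ObsSpace) :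
    M.mode ε ω q (M.obsTime γ ε p) (M.obsPoint γ ε p) =
      Complex.exp (-Complex.I * ω *
        ((p.1 - ⟪q, p.2.1⟫_ℝ - ε ^ γ / √ε * ⟪q, p.2.2⟫_ℝ : ℝ) : ℂ)) := by
  have hs : (√ε : ℝ) ≠ 0 := (Real.sqrt_pos.2 hε).ne'
  have e1 : M.obsTime γ ε p - M.slow 0 * M.zInt - M.slow 1 * (M.zTr - M.zInt) -
      ⟪M.obsPoint γ ε p, M.k₀⟫_ℝ = ε * p.1 := by
    rw [obsTime, obsPoint, M.tObs_eq, inner_add_left, inner_add_left, real_inner_smul_left,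
      real_inner_smul_left, real_inner_comm M.k₀ p.2.1, real_inner_comm M.k₀ p.2.2]
    ring
  have e2 : ⟪q, M.obsPoint γ ε p - M.xObs⟫_ℝ = √ε * ⟪q, p.2.1⟫_ℝ + ε ^ γ * ⟪q, p.2.2⟫_ℝ := by
    rw [obsPoint, add_assoc, add_sub_cancel_left, inner_add_right, real_inner_smul_right,
      real_inner_smul_right]
  rw [mode, e1, e2, ← Complex.exp_add]
  congr 1
  have hε' : (ε : ℂ) ≠ 0 := by exact_mod_cast hε.ne'
  have hs' : ((√ε : ℝ) : ℂ) ≠ 0 := by exact_mod_cast hs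
  rw [Complex.ofReal_mul, Complex.ofReal_add, Complex.ofReal_sub, Complex.ofReal_sub,
    Complex.ofReal_mul, Complex.ofReal_mul, Complex.ofReal_mul, Complex.ofReal_div]
  field_simp
  ring

/-- The transmitted mode paired with a test function, as a function of the ratio `δ` of the scales
of `ỹ` and `y`. -/
noncomputable def transmitted (δ : ℝ) (φ : 𝓢(ObsSpace, ℂ)) (ω : ℝ) (q : Plane) : ℂ :=
  M.propagator 1 ω q (M.zTr - M.zInt) * modeTransform δ φ ω q

theorem testedMode_eq (γ : ℝ) {ε : ℝ} (hε : 0 < ε) (φ : 𝓢(ObsSpace, ℂ)) (ω : ℝ) :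
    M.testedMode γ ε φ ω = M.transmitted (ε ^ γ / √ε) φ ω := by
  ext q
  simp_rw [testedMode, transmitted, modeTransform, M.mode_obs γ hε]

theorem continuous_transmitted (φ : 𝓢(ObsSpace, ℂ)) :
    Continuous fun x : ℝ × ℝ × Plane => M.transmitted x.1 φ x.2.1 x.2.2 :=
  ((M.continuous_propagator 1 _).comp continuous_snd).mul (continuous_modeTransform φ)

theorem transmitted_add (δ : ℝ) (φ ψ : 𝓢(ObsSpace, ℂ)) (ω : ℝ) :
    M.transmitted δ (φ + ψ) ω = M.transmitted δ φ ω + M.transmitted δ ψ ω := by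
  ext q
  simp [transmitted, modeTransform_eq, mul_add]

theorem transmitted_smul (δ : ℝ) (a : ℂ) (φ : 𝓢(ObsSpace, ℂ)) (ω : ℝ) :
    M.transmitted δ (a • φ) ω = a • M.transmitted δ φ ω := by
  ext q
  simp [transmitted, modeTransform_eq, mul_left_comm]

/-- The propagator has modulus one, and the lower bound on `|ω|` makes the majorant independent of
both `δ` and `ω`. -/
theorem norm_transmitted_le {φ : 𝓢(ObsSpace, ℂ)} {A : ℝ} (h : FourierDecay φ A) (δ : ℝ) {a ω : ℝ}
    (ha : 0 < a) (hω : a ≤ |ω|) (q : Plane) :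
    ‖M.transmitted δ φ ω q‖ ≤ A * decayWeight (a / (2 * Real.pi)) q := by
  rw [transmitted, norm_mul, norm_propagator, one_mul]
  refine (h.norm_modeTransform_le δ ω q).trans ?_
  have hA := h.nonneg
  gcongr
  rw [mul_div_right_comm]
  exact decayWeight_anti (by positivity) (by gcongr) q

section Transmitted

variable (δ : ℝ) (φ : 𝓢(ObsSpace, ℂ)) {ω : ℝ}

theorem continuous_transmitted_apply (ω : ℝ) : Continuous (M.transmitted δ φ ω) := by
  have h : Continuous fun q : Plane => (δ, ω, q) := by fun_prop
  exact ((M.continuous_transmitted φ).comp h).congr fun q => by rw [Function.comp_apply]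

theorem integrable_transmitted (hω : ω ≠ 0) : Integrable (M.transmitted δ φ ω) := by
  have hω' := abs_pos.2 hω
  exact ((integrable_decayWeight (by positivity)).const_mul _).mono'
    (M.continuous_transmitted_apply δ φ ω).aestronglyMeasurable
    (ae_of_all _ (M.norm_transmitted_le (fourierDecay_seminorm φ) δ hω' le_rfl))

theorem memLp_transmitted (hω : ω ≠ 0) : MemLp (M.transmitted δ φ ω) 2 := by
  have hω' := abs_pos.2 hω
  exact ((memLp_decayWeight (by positivity)).const_mul _).mono'
    (M.continuous_transmitted_apply δ φ ω).aestronglyMeasurable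
    (ae_of_all _ (M.norm_transmitted_le (fourierDecay_seminorm φ) δ hω' le_rfl))

end Transmitted

theorem eLpNorm_transmitted_le {φ : 𝓢(ObsSpace, ℂ)} {A : ℝ} (h : FourierDecay φ A) (δ : ℝ)
    {a ω : ℝ} (ha : 0 < a) (hω : a ≤ |ω|) :
    eLpNorm (M.transmitted δ φ ω) 2 volume ≤
      ENNReal.ofReal A * eLpNorm (decayWeight (a / (2 * Real.pi))) 2 volume := by
  refine (eLpNorm_mono_real (M.norm_transmitted_le h δ ha hω)).trans ?_
  have := eLpNorm_const_smul A (decayWeight (a / (2 * Real.pi))) 2 volume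
  rw [Real.enorm_of_nonneg h.nonneg] at this
  exact this.le

/-- Dominated convergence with the `δ`-independent decay weight. This is where the dependence on `ỹ`
is lost. -/
theorem tendsto_eLpNorm_transmitted_sub (φ : 𝓢(ObsSpace, ℂ)) {ω : ℝ} (hω : ω ≠ 0) :
    Tendsto (fun δ => eLpNorm (M.transmitted δ φ ω - M.transmitted 0 φ ω) 2 volume)
      (𝓝 0) (𝓝 0) := by
  have hω' := abs_pos.2 hω
  set A := 2 ^ 4 *
    ((Finset.Iic (4, 0)).sup (schwartzSeminormFamily ℂ EuclideanObs ℂ)) (obsFourier φ)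
  have hb : ∀ δ q, ‖(M.transmitted δ φ ω - M.transmitted 0 φ ω) q‖ ≤
      2 * A * decayWeight (|ω| / (2 * Real.pi)) q := fun δ q => by
    have h1 := M.norm_transmitted_le (fourierDecay_seminorm φ) δ hω' le_rfl q
    have h2 := M.norm_transmitted_le (fourierDecay_seminorm φ) 0 hω' le_rfl q
    refine (norm_sub_le _ _).trans ?_
    linarith
  have hcont : ∀ δ, Continuous (M.transmitted δ φ ω - M.transmitted 0 φ ω) := fun δ =>
    (M.continuous_transmitted_apply δ φ ω).sub (M.continuous_transmitted_apply 0 φ ω)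
  have hW : MemLp (fun q => 2 * A * decayWeight (|ω| / (2 * Real.pi)) q) 2 :=
    (memLp_decayWeight (by positivity)).const_mul _
  have key : Tendsto (fun δ => ∫⁻ q, ‖(M.transmitted δ φ ω - M.transmitted 0 φ ω) q‖ₑ ^ (2 : ℝ))
      (𝓝 0) (𝓝 0) := by
    rw [show (0 : ENNReal) = ∫⁻ _ : Plane, 0 by simp]
    refine tendsto_lintegral_filter_of_dominated_convergence
      (fun q => ‖2 * A * decayWeight (|ω| / (2 * Real.pi)) q‖ₑ ^ (2 : ℝ))
      (Eventually.of_forall fun δ => ?_) (Eventually.of_forall fun δ => ae_of_all _ fun q => ?_)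
      ?_ (ae_of_all _ fun q => ?_)
    · exact ((hcont δ).enorm.measurable.pow_const _)
    · gcongr
      rw [enorm_le_iff_norm_le]
      exact (hb δ q).trans (le_abs_self _)
    · exact (lintegral_rpow_enorm_lt_top_of_eLpNorm_lt_top (by norm_num) (by norm_num) hW.2).ne
    · have h1 : Continuous fun δ => (M.transmitted δ φ ω - M.transmitted 0 φ ω) q :=
        (Continuous.comp (g := fun x : ℝ × ℝ × Plane => M.transmitted x.1 φ x.2.1 x.2.2)
          (M.continuous_transmitted φ)
          (by fun_prop : Continuous fun δ : ℝ => (δ, ω, q))).sub continuous_const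
      have h2 : Tendsto (fun δ => ‖(M.transmitted δ φ ω - M.transmitted 0 φ ω) q‖ₑ ^ (2 : ℝ)) (𝓝 0)
          (𝓝 (‖(M.transmitted 0 φ ω - M.transmitted 0 φ ω) q‖ₑ ^ (2 : ℝ))) :=
        ((ENNReal.continuous_rpow_const.comp h1.enorm).tendsto 0)
      simpa using h2
  have h3 := (ENNReal.continuous_rpow_const (y := (1 / 2 : ℝ))).tendsto 0 |>.comp key
  rw [ENNReal.zero_rpow_of_pos (by norm_num)] at h3
  refine h3.congr fun δ => ?_
  rw [eLpNorm_eq_lintegral_rpow_enorm_toReal (by norm_num) (by norm_num)]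
  simp

/-! ### The incident amplitude -/

section Incoming

variable {Ψ : ℝ × Plane → ℂ} (hΨ : IsAdmissibleSource Ψ)
include hΨ

theorem continuous_incoming : Continuous fun p : ℝ × Plane => M.incoming Ψ p.1 p.2 :=
  (M.continuous_propagator 0 _).mul (continuous_sourceTransform hΨ.integrable)

end Incoming

/-- The amplitude has the modulus of `Ψ̂`, hence is dominated by `∫ |Ψ|` times the indicator of a
fixed ball. This gives all the bounds uniformly in `ω`. -/
theorem exists_incoming_bounds {Ψ : ℝ × Plane → ℂ} (hΨ : IsAdmissibleSource Ψ) :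
    ∃ a > 0, ∃ R > 0, ∃ K : ENNReal, K ≠ ⊤ ∧
      (∀ ω, |ω| < a ∨ R < |ω| → M.incoming Ψ ω = 0) ∧
      ∀ ω, Integrable (M.incoming Ψ ω) ∧ MemLp (M.incoming Ψ ω) 2 ∧
        eLpNorm (M.incoming Ψ ω) 2 volume ≤ K := by
  obtain ⟨a, ha, hsmall⟩ := hΨ.awayFromZero
  obtain ⟨R, hR, hlarge⟩ := hΨ.exists_bound
  set C := ∫ p, ‖Ψ p‖ with hC
  have hC0 : 0 ≤ C := integral_nonneg fun _ => norm_nonneg _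
  let B : Plane → ℝ := (Metric.closedBall (0 : Plane) R).indicator fun _ => C
  have hB : MemLp B 2 := memLp_indicator_const 2 measurableSet_closedBall C
    (Or.inr measure_closedBall_lt_top.ne)
  have hB1 : Integrable B := (integrable_indicator_iff measurableSet_closedBall).2
    (integrableOn_const measure_closedBall_lt_top.ne)
  have hle : ∀ ω q, ‖M.incoming Ψ ω q‖ ≤ B q := by
    intro ω q
    rw [incoming, norm_mul, norm_propagator, one_mul]
    by_cases hq : ‖q‖ ≤ R
    · have hq' : q ∈ Metric.closedBall (0 : Plane) R := by simpa using hq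
      simpa [B, hq'] using norm_sourceTransform_le Ψ ω q
    · rw [hlarge ω q (Or.inr (not_le.1 hq)), norm_zero]
      exact Set.indicator_nonneg (fun _ _ => hC0) q
  have hm : ∀ ω, AEStronglyMeasurable (M.incoming Ψ ω) := fun ω =>
    (((M.continuous_incoming hΨ).comp (by fun_prop : Continuous fun q : Plane => (ω, q))).congr
      fun q => by rw [Function.comp_apply]).aestronglyMeasurable
  refine ⟨a, ha, R, hR, eLpNorm B 2 volume, hB.2.ne, fun ω hω => ?_, fun ω => ⟨?_, ?_, ?_⟩⟩
  · ext q
    have : sourceTransform Ψ ω q = 0 :=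
      hω.elim (hsmall ω q) fun h => hlarge ω q (Or.inl h)
    simp [incoming, this]
  · exact hB1.mono' (hm ω) (ae_of_all _ (hle ω))
  · exact hB.mono' (hm ω) (ae_of_all _ (hle ω))
  · exact eLpNorm_mono_real (hle ω)

/-! ### The scattering operator in Fourier variables -/

section Scatter

open FourierTransform

/-- The ratio of the spatial frequency scale `√ε / ω` of the wave and the scale `ε^γ` of the
interface. -/
noncomputable def scaleRatio (γ ε ω : ℝ) : ℝ := (ε ^ γ)⁻¹ * (2 * Real.pi * √ε / ω)

variable {γ ε τ ω : ℝ} (hε : 0 < ε) (hω : ω ≠ 0) (v : Plane → ℝ) {F G : Plane → ℂ}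
include hε hω

/-- With this scaling `ω q·(x' - x_int)/√ε` equals `2π q·η`, which is the normalization of `𝓕` and
`𝓕⁻`. -/
theorem scatterIntegrand_comp (F G : Plane → ℂ) (η : Plane) :
    M.scatterIntegrand γ ε τ ω v F G (M.xInt + (2 * Real.pi * √ε / ω) • η) =
      Complex.exp (((ω * τ * v ((ε ^ γ)⁻¹ • M.xInt + scaleRatio γ ε ω • η) : ℝ) : ℂ) * Complex.I) *
        (𝓕 F η * 𝓕⁻ G η) := by
  have hs : ((√ε : ℝ) : ℂ) ≠ 0 := by exact_mod_cast (Real.sqrt_pos.2 hε).ne'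
  have hω' : (ω : ℂ) ≠ 0 := by exact_mod_cast hω
  rw [scatterIntegrand, mul_assoc, Real.fourier_eq', Real.fourierInv_eq', smul_add, smul_smul,
    ← scaleRatio]
  refine congrArg₂ _ (congrArg _ ?_) (congrArg₂ _ ?_ ?_)
  · push_cast; ring
  · refine integral_congr_ae (ae_of_all _ fun q => ?_)
    simp only [smul_eq_mul, add_sub_cancel_left, real_inner_smul_right]
    congr 2
    push_cast
    field_simp
  · refine integral_congr_ae (ae_of_all _ fun q => ?_)
    simp only [smul_eq_mul, add_sub_cancel_left, real_inner_smul_right]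
    congr 2
    push_cast
    field_simp

/-- The planar Jacobian `(2π√ε/ω)²` is the inverse of the prefactor, so `ε` survives only in the
argument of `v`. -/
theorem scatter_eq (F G : Plane → ℂ) :
    M.scatter γ ε τ ω v F G = ∫ η : Plane,
      Complex.exp (((ω * τ * v ((ε ^ γ)⁻¹ • M.xInt + scaleRatio γ ε ω • η) : ℝ) : ℂ) * Complex.I) *
        (𝓕 F η * 𝓕⁻ G η) := by
  simp_rw [← M.scatterIntegrand_comp hε hω v F G]
  rw [Measure.integral_comp_smul volume
    (fun y => M.scatterIntegrand γ ε τ ω v F G (M.xInt + y)) (2 * Real.pi * √ε / ω),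
    integral_add_left_eq_self (fun y => M.scatterIntegrand γ ε τ ω v F G y) M.xInt, scatter]
  rw [Complex.real_smul]
  congr 2
  have hs := Real.sq_sqrt hε.le
  have := (Real.sqrt_pos.2 hε).ne'
  have := Real.pi_ne_zero
  rw [show Module.finrank ℝ Plane = 2 by simp, abs_of_nonneg (by positivity)]
  field_simp
  rw [hs]

theorem integrable_scatterIntegrand (hv : Continuous v) (hF : Integrable F) (hF2 : MemLp F 2)
    (hG : Integrable G) (hG2 : MemLp G 2) : Integrable (M.scatterIntegrand γ ε τ ω v F G) := by
  have hne : 2 * Real.pi * √ε / ω ≠ 0 := by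
    have := (Real.sqrt_pos.2 hε).ne'
    have := Real.pi_ne_zero
    positivity
  have h1 : Integrable fun y => M.scatterIntegrand γ ε τ ω v F G (M.xInt + y) := by
    rw [← integrable_comp_smul_iff volume _ hne]
    simp_rw [M.scatterIntegrand_comp hε hω v F G]
    refine (integrable_fourier_mul_fourierInv hF hF2 hG hG2).bdd_mul (c := 1) ?_
      (ae_of_all _ fun η => (Complex.norm_exp_ofReal_mul_I _).le)
    exact Continuous.aestronglyMeasurable (by fun_prop)
  simpa using h1.comp_add_left (-M.xInt)

/-- The interface phase has modulus one and drops out of the estimate, which is therefore uniform in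
the interface and in `ε`. -/
theorem enorm_scatter_le (hF : Integrable F) (hF2 : MemLp F 2) (hG : Integrable G)
    (hG2 : MemLp G 2) :
    ‖M.scatter γ ε τ ω v F G‖ₑ ≤ eLpNorm F 2 volume * eLpNorm G 2 volume := by
  rw [M.scatter_eq hε hω]
  refine (enorm_integral_le_lintegral_enorm _).trans
    (le_trans (le_of_eq ?_) (lintegral_fourier_mul_fourierInv_le hF hF2 hG hG2))
  refine lintegral_congr fun η => ?_
  rw [enorm_mul, ← ofReal_norm, Complex.norm_exp_ofReal_mul_I, ENNReal.ofReal_one, one_mul]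

omit hε hω in
theorem scatterIntegrand_add {F₁ F₂ : Plane → ℂ} (hF₁ : Integrable F₁) (hF₂ : Integrable F₂)
    (x : Plane) : M.scatterIntegrand γ ε τ ω v (F₁ + F₂) G x =
      M.scatterIntegrand γ ε τ ω v F₁ G x + M.scatterIntegrand γ ε τ ω v F₂ G x := by
  have hi : ∀ F : Plane → ℂ, Integrable F → Integrable fun q : Plane =>
      Complex.exp (-Complex.I * ω * ((⟪q, x - M.xInt⟫_ℝ : ℝ) : ℂ) / (√ε : ℝ)) * F q := by
    intro F hF
    refine hF.bdd_mul (c := 1) (Continuous.aestronglyMeasurable (by fun_prop))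
      (ae_of_all _ fun q => le_of_eq ?_)
    have : -Complex.I * ω * ((⟪q, x - M.xInt⟫_ℝ : ℝ) : ℂ) / (√ε : ℝ) =
        Complex.I * ((-(ω * ⟪q, x - M.xInt⟫_ℝ / √ε) : ℝ) : ℂ) := by push_cast; ring
    rw [this, norm_exp_I_mul_ofReal]
  simp only [scatterIntegrand, Pi.add_apply, mul_add]
  rw [integral_add (hi _ hF₁) (hi _ hF₂)]
  ring

omit hε hω in
theorem scatter_smul (a : ℂ) (F : Plane → ℂ) :
    M.scatter γ ε τ ω v (a • F) G = a * M.scatter γ ε τ ω v F G := by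
  have : ∀ x, M.scatterIntegrand γ ε τ ω v (a • F) G x =
      a * M.scatterIntegrand γ ε τ ω v F G x := by
    intro x
    simp only [scatterIntegrand, Pi.smul_apply, smul_eq_mul, mul_left_comm _ a]
    rw [integral_const_mul]
    ring
  simp only [scatter, this]
  rw [integral_const_mul]
  ring

theorem scatter_add (hv : Continuous v) {F₁ F₂ : Plane → ℂ} (hF₁ : Integrable F₁)
    (hF₁2 : MemLp F₁ 2) (hF₂ : Integrable F₂) (hF₂2 : MemLp F₂ 2)
    (hG : Integrable G) (hG2 : MemLp G 2) :
    M.scatter γ ε τ ω v (F₁ + F₂) G = M.scatter γ ε τ ω v F₁ G + M.scatter γ ε τ ω v F₂ G := by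
  simp only [scatter, M.scatterIntegrand_add v hF₁ hF₂]
  rw [integral_add (M.integrable_scatterIntegrand hε hω v hv hF₁ hF₁2 hG hG2)
    (M.integrable_scatterIntegrand hε hω v hv hF₂ hF₂2 hG hG2), mul_add]

/-- By Parseval the subtracted term is the same `η` integral with the phase replaced by its mean. -/
theorem scatter_sub_average {Ω : Type*} [MeasurableSpace Ω] (P : Measure Ω) (V : Ω → Plane → ℝ)
    (w : Ω) (hv : Continuous (V w)) (hF : Integrable F) (hF2 : MemLp F 2) (hG : Integrable G)
    (hG2 : MemLp G 2) :
    M.scatter γ ε τ ω (V w) F G - elevationCharFun P V (ω * τ) * ∫ q, F q * G q =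
      ∫ η, centredPhase P V (ω * τ) w ((ε ^ γ)⁻¹ • M.xInt + scaleRatio γ ε ω • η) *
        (𝓕 F η * 𝓕⁻ G η) := by
  have hi := integrable_fourier_mul_fourierInv hF hF2 hG hG2
  rw [M.scatter_eq hε hω, ← integral_fourier_mul_fourierInv hF hF2 hG hG2, ← integral_const_mul,
    ← integral_sub]
  · simp only [centredPhase, sub_mul]
  · exact hi.bdd_mul (c := 1) (Continuous.aestronglyMeasurable (by fun_prop))
      (ae_of_all _ fun η => (Complex.norm_exp_ofReal_mul_I _).le)
  · exact hi.const_mul _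

end Scatter

/-- For `ε > 0` the modulus is `(2π/|ω|) ε^(1/2-γ)`: the interface varies on a scale much shorter
than the beam width `√ε`. -/
theorem tendsto_abs_scaleRatio {γ ω : ℝ} (hγ : 1 / 2 < γ) (hω : ω ≠ 0) :
    Tendsto (fun ε => |scaleRatio γ ε ω|) (𝓝[>] 0) atTop := by
  have h1 : Tendsto (fun ε : ℝ => (2 * Real.pi / |ω|) * ε ^ (-(γ - 1 / 2))) (𝓝[>] 0) atTop :=
    (tendsto_rpow_neg_nhdsGT_zero (by linarith)).const_mul_atTop (by positivity)
  refine h1.congr' ?_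
  filter_upwards [self_mem_nhdsWithin] with ε hε
  have hε' : 0 < ε := hε
  rw [scaleRatio, abs_mul, abs_div, abs_of_pos (inv_pos.2 (Real.rpow_pos_of_pos hε' γ)),
    abs_of_nonneg (by positivity : 0 ≤ 2 * Real.pi * √ε), Real.sqrt_eq_rpow,
    show -(γ - 1 / 2) = -γ + 1 / 2 by ring, Real.rpow_add hε', Real.rpow_neg hε'.le]
  ring

theorem tendsto_scale_ratio_zero {γ : ℝ} (hγ : 1 / 2 < γ) :
    Tendsto (fun ε : ℝ => ε ^ γ / √ε) (𝓝[>] 0) (𝓝 0) := by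
  have h1 : Tendsto (fun ε : ℝ => ε ^ (γ - 1 / 2)) (𝓝[>] 0) (𝓝 0) := by
    have := (Real.continuousAt_rpow_const 0 (γ - 1 / 2) (Or.inr (by linarith))).tendsto
    rw [Real.zero_rpow (by linarith)] at this
    exact this.mono_left nhdsWithin_le_nhds
  refine h1.congr' ?_
  filter_upwards [self_mem_nhdsWithin] with ε hε
  rw [Real.sqrt_eq_rpow, Real.rpow_sub hε]

end Setup

/-- A frequency integral of linear functionals controlled by the Fourier decay of the test function
is a tempered distribution. -/
theorem exists_temperedDist_of_bound (c : ℂ) (Λ : 𝓢(ObsSpace, ℂ) → ℝ → ℂ)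
    (hadd : ∀ φ ψ ω, Λ (φ + ψ) ω = Λ φ ω + Λ ψ ω) (hsmul : ∀ (a : ℂ) φ ω, Λ (a • φ) ω = a * Λ φ ω)
    (hint : ∀ φ, Integrable (Λ φ)) {R C : ℝ} (hR : 0 < R)
    (hbd : ∀ φ A, FourierDecay φ A → ∀ ω,
      ‖Λ φ ω‖ ≤ (Set.Icc (-R) R).indicator (fun _ => C * A) ω) :
    ∃ T : TemperedDist, (∀ φ, T φ = c * ∫ ω, Λ φ ω) ∧
      ∀ φ A, FourierDecay φ A → ‖T φ‖ ≤ ‖c‖ * (2 * R * C) * A := by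
  let T : 𝓢(ObsSpace, ℂ) →ₗ[ℂ] ℂ :=
    { toFun := fun φ => c * ∫ ω, Λ φ ω
      map_add' := fun φ ψ => by
        simp_rw [hadd]
        rw [integral_add (hint φ) (hint ψ), mul_add]
      map_smul' := fun a φ => by
        simp_rw [hsmul]
        rw [integral_const_mul, RingHom.id_apply, smul_eq_mul]
        ring }
  have hT : ∀ φ A, FourierDecay φ A → ‖T φ‖ ≤ ‖c‖ * (2 * R * C) * A := by
    intro φ A hA
    have h1 : ‖∫ ω, Λ φ ω‖ ≤ ∫ ω, (Set.Icc (-R) R).indicator (fun _ => C * A) ω :=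
      norm_integral_le_of_norm_le ((integrable_indicator_iff measurableSet_Icc).2
        (integrableOn_const (by simp))) (ae_of_all _ (hbd φ A hA))
    rw [integral_indicator measurableSet_Icc, setIntegral_const, smul_eq_mul, Real.volume_real_Icc,
      max_eq_left (by linarith)] at h1
    calc ‖T φ‖ = ‖c‖ * ‖∫ ω, Λ φ ω‖ := norm_mul _ _
      _ ≤ ‖c‖ * ((R - -R) * (C * A)) := by gcongr
      _ = ‖c‖ * (2 * R * C) * A := by ring
  exact ⟨functionalOfFourierDecay T ⟨_, hT⟩, fun φ => rfl, hT⟩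

/-! ### Frequency integrands of the front and of its limit -/

namespace Setup

variable (M : Setup)

/-- The frequency integrand of the pairing of the homogenized profile with a test function. -/
noncomputable def limitIntegrand (Ψ : ℝ × Plane → ℂ) (χ : ℝ → ℂ) (φ : 𝓢(ObsSpace, ℂ)) (ω : ℝ) :
    ℂ :=
  χ (ω * (M.slow 0 - M.slow 1)) * (∫ q, M.transmitted 0 φ ω q * M.incoming Ψ ω q) *
    ((ω ^ 2 : ℝ) : ℂ)

theorem frontIntegrand_eq (γ : ℝ) {ε : ℝ} (hε : 0 < ε) (Ψ : ℝ × Plane → ℂ) (v : Plane → ℝ)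
    (φ : 𝓢(ObsSpace, ℂ)) (ω : ℝ) :
    M.frontIntegrand γ ε Ψ v φ ω = M.scatter γ ε (M.slow 0 - M.slow 1) ω v
      (M.transmitted (ε ^ γ / √ε) φ ω) (M.incoming Ψ ω) * ((ω ^ 2 : ℝ) : ℂ) := by
  rw [frontIntegrand, M.testedMode_eq γ hε]

theorem frontIntegrand_of_incoming_eq_zero {γ ε ω : ℝ} {Ψ : ℝ × Plane → ℂ}
    (h : M.incoming Ψ ω = 0) (v : Plane → ℝ) (φ : 𝓢(ObsSpace, ℂ)) :
    M.frontIntegrand γ ε Ψ v φ ω = 0 := by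
  simp [frontIntegrand, h, scatter, scatterIntegrand]

theorem limitIntegrand_of_incoming_eq_zero {ω : ℝ} {Ψ : ℝ × Plane → ℂ} (h : M.incoming Ψ ω = 0)
    (χ : ℝ → ℂ) (φ : 𝓢(ObsSpace, ℂ)) : M.limitIntegrand Ψ χ φ ω = 0 := by
  simp [limitIntegrand, h]

section Bounds

variable {Ψ : ℝ × Plane → ℂ} (hΨ : IsAdmissibleSource Ψ)
include hΨ

theorem integrable_memLp_incoming (ω : ℝ) :
    Integrable (M.incoming Ψ ω) ∧ MemLp (M.incoming Ψ ω) 2 := by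
  obtain ⟨_, _, _, _, _, _, _, h⟩ := M.exists_incoming_bounds hΨ
  exact ⟨(h ω).1, (h ω).2.1⟩

theorem integrable_transmitted_mul_incoming (δ : ℝ) (φ : 𝓢(ObsSpace, ℂ)) {ω : ℝ} (hω : ω ≠ 0) :
    Integrable fun q => M.transmitted δ φ ω q * M.incoming Ψ ω q :=
  (M.memLp_transmitted δ φ hω).integrable_mul (M.integrable_memLp_incoming hΨ ω).2

theorem frontIntegrand_add (γ : ℝ) {ε : ℝ} (hε : 0 < ε) {v : Plane → ℝ} (hv : Continuous v)
    (φ ψ : 𝓢(ObsSpace, ℂ)) (ω : ℝ) :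
    M.frontIntegrand γ ε Ψ v (φ + ψ) ω =
      M.frontIntegrand γ ε Ψ v φ ω + M.frontIntegrand γ ε Ψ v ψ ω := by
  rcases eq_or_ne ω 0 with rfl | hω
  · simp [frontIntegrand]
  · obtain ⟨h1, h2⟩ := M.integrable_memLp_incoming hΨ ω
    simp only [M.frontIntegrand_eq γ hε, transmitted_add]
    rw [M.scatter_add hε hω v hv (M.integrable_transmitted _ _ hω) (M.memLp_transmitted _ _ hω)
      (M.integrable_transmitted _ _ hω) (M.memLp_transmitted _ _ hω) h1 h2, add_mul]

omit hΨ in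
theorem frontIntegrand_smul (γ : ℝ) {ε : ℝ} (hε : 0 < ε) (v : Plane → ℝ) (a : ℂ)
    (φ : 𝓢(ObsSpace, ℂ)) (ω : ℝ) :
    M.frontIntegrand γ ε Ψ v (a • φ) ω = a * M.frontIntegrand γ ε Ψ v φ ω := by
  simp only [M.frontIntegrand_eq γ hε, transmitted_smul, scatter_smul, mul_assoc]

theorem limitIntegrand_add (χ : ℝ → ℂ) (φ ψ : 𝓢(ObsSpace, ℂ)) (ω : ℝ) :
    M.limitIntegrand Ψ χ (φ + ψ) ω = M.limitIntegrand Ψ χ φ ω + M.limitIntegrand Ψ χ ψ ω := by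
  rcases eq_or_ne ω 0 with rfl | hω
  · simp [limitIntegrand]
  · simp only [limitIntegrand, transmitted_add, Pi.add_apply, add_mul]
    rw [integral_add (M.integrable_transmitted_mul_incoming hΨ 0 φ hω)
      (M.integrable_transmitted_mul_incoming hΨ 0 ψ hω)]
    ring

omit hΨ in
theorem limitIntegrand_smul (χ : ℝ → ℂ) (a : ℂ) (φ : 𝓢(ObsSpace, ℂ)) (ω : ℝ) :
    M.limitIntegrand Ψ χ (a • φ) ω = a * M.limitIntegrand Ψ χ φ ω := by
  simp only [limitIntegrand, transmitted_smul, Pi.smul_apply, smul_eq_mul, mul_assoc]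
  rw [integral_const_mul]
  ring

/-- One constant serves every `ε`, every interface and the limit, because the Plancherel estimate
ignores the phase. The support of the source supplies the frequency window and the lower cutoff that
keeps the decay weight in `L²`. -/
theorem exists_integrand_bound (γ : ℝ) {χ : ℝ → ℂ} (hχ : ∀ u, ‖χ u‖ ≤ 1) :
    ∃ R > 0, ∃ C : ℝ, ∀ φ A, FourierDecay φ A → ∀ ω,
      (∀ ε > 0, ∀ v, ‖M.frontIntegrand γ ε Ψ v φ ω‖ ≤
        (Set.Icc (-R) R).indicator (fun _ => C * A) ω) ∧
      ‖M.limitIntegrand Ψ χ φ ω‖ ≤ (Set.Icc (-R) R).indicator (fun _ => C * A) ω := by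
  obtain ⟨a, ha, R, hR, K, hK, hzero, hG⟩ := M.exists_incoming_bounds hΨ
  set W := eLpNorm (decayWeight (a / (2 * Real.pi))) 2 volume with hW
  have hWt : W ≠ ⊤ := (memLp_decayWeight (by positivity)).2.ne
  refine ⟨R, hR, (W * K).toReal * R ^ 2, fun φ A hA ω => ?_⟩
  by_cases hω : |ω| < a ∨ R < |ω|
  · have h0 : (0 : ℝ) ≤ (Set.Icc (-R) R).indicator (fun _ => (W * K).toReal * R ^ 2 * A) ω :=
      Set.indicator_nonneg (fun _ _ => by have := hA.nonneg; positivity) _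
    refine ⟨fun ε _ v => ?_, ?_⟩
    · rwa [M.frontIntegrand_of_incoming_eq_zero (hzero ω hω), norm_zero]
    · rwa [M.limitIntegrand_of_incoming_eq_zero (hzero ω hω), norm_zero]
  · rw [not_or, not_lt, not_lt] at hω
    obtain ⟨haω, hωR⟩ := hω
    have hω0 : ω ≠ 0 := abs_pos.1 (ha.trans_le haω)
    have hA0 := hA.nonneg
    rw [Set.indicator_of_mem (Set.mem_Icc.2 (abs_le.1 hωR))]
    have hprod : ∀ δ, eLpNorm (M.transmitted δ φ ω) 2 volume *
        eLpNorm (M.incoming Ψ ω) 2 volume ≤ ENNReal.ofReal ((W * K).toReal * A) := by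
      intro δ
      refine (mul_le_mul' (M.eLpNorm_transmitted_le hA δ ha haω) (hG ω).2.2).trans ?_
      rw [ENNReal.ofReal_mul ENNReal.toReal_nonneg,
        ENNReal.ofReal_toReal (ENNReal.mul_ne_top hWt hK)]
      exact le_of_eq (by ring)
    have hfin : ∀ z : ℂ, ‖z‖ₑ ≤ ENNReal.ofReal ((W * K).toReal * A) →
        ‖z * ((ω ^ 2 : ℝ) : ℂ)‖ ≤ (W * K).toReal * R ^ 2 * A := by
      intro z hz
      have hz' : ‖z‖ ≤ (W * K).toReal * A := by
        rw [← ofReal_norm, ENNReal.ofReal_le_ofReal_iff (by positivity)] at hz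
        exact hz
      have hsq : ω ^ 2 ≤ R ^ 2 := sq_le_sq' (abs_le.1 hωR).1 (abs_le.1 hωR).2
      rw [norm_mul, Complex.norm_real, Real.norm_of_nonneg (sq_nonneg ω)]
      calc ‖z‖ * ω ^ 2 ≤ ((W * K).toReal * A) * R ^ 2 := by gcongr
        _ = _ := by ring
    refine ⟨fun ε hε v => ?_, ?_⟩
    · rw [M.frontIntegrand_eq γ hε]
      exact hfin _ ((M.enorm_scatter_le hε hω0 v (M.integrable_transmitted _ φ hω0)
        (M.memLp_transmitted _ φ hω0) (hG ω).1 (hG ω).2.1).trans (hprod _))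
    -- Parseval writes the limit as an `η` integral with a constant factor of modulus at most one,
    -- so the same estimate applies.
    · refine hfin _ (le_trans ?_ (hprod 0))
      rw [enorm_mul, ← integral_fourier_mul_fourierInv (M.integrable_transmitted 0 φ hω0)
        (M.memLp_transmitted 0 φ hω0) (hG ω).1 (hG ω).2.1]
      have h1 : ‖χ (ω * (M.slow 0 - M.slow 1))‖ₑ ≤ 1 := by
        rw [← ofReal_norm]
        exact ENNReal.ofReal_le_one.2 (hχ _)
      refine (mul_le_mul' h1 (enorm_integral_le_lintegral_enorm _)).trans ?_
      rw [one_mul]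
      exact lintegral_fourier_mul_fourierInv_le (M.integrable_transmitted 0 φ hω0)
        (M.memLp_transmitted 0 φ hω0) (hG ω).1 (hG ω).2.1

/-! ### Measurability -/

theorem measurable_limitIntegrand {χ : ℝ → ℂ} (hχ : Continuous χ) (φ : 𝓢(ObsSpace, ℂ)) :
    Measurable (M.limitIntegrand Ψ χ φ) := by
  have h1 : Continuous fun x : ℝ × Plane => M.transmitted 0 φ x.1 x.2 * M.incoming Ψ x.1 x.2 := by
    refine Continuous.mul ?_ (M.continuous_incoming hΨ)
    exact ((M.continuous_transmitted φ).comp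
      (by fun_prop : Continuous fun x : ℝ × Plane => ((0 : ℝ), x.1, x.2))).congr
      fun x => by rw [Function.comp_apply]
  have h2 : Measurable fun ω : ℝ => ∫ q, M.transmitted 0 φ ω q * M.incoming Ψ ω q :=
    (h1.stronglyMeasurable.integral_prod_right' (ν := volume)).measurable
  have h3 : Measurable fun ω : ℝ => χ (ω * (M.slow 0 - M.slow 1)) :=
    hχ.measurable.comp (by fun_prop)
  unfold limitIntegrand
  exact (h3.mul h2).mul (by fun_prop)

/-- Each inner integral is a parameter integral of a jointly measurable integrand. Joint
measurability in realization and frequency is what Tonelli's theorem requires later. -/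
theorem measurable_frontIntegrand {Ω : Type*} [MeasurableSpace Ω] {V : Ω → Plane → ℝ}
    (hV : Measurable fun p : Ω × Plane => V p.1 p.2) (γ : ℝ) {ε : ℝ} (hε : 0 < ε)
    (φ : 𝓢(ObsSpace, ℂ)) :
    Measurable fun p : Ω × ℝ => M.frontIntegrand γ ε Ψ (V p.1) φ p.2 := by
  set δ := ε ^ γ / √ε with hδ
  have hT : Continuous fun x : (ℝ × Plane) × Plane => M.transmitted δ φ x.1.1 x.2 :=
    ((M.continuous_transmitted φ).comp
      (by fun_prop : Continuous fun x : (ℝ × Plane) × Plane => (δ, x.1.1, x.2))).congr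
      fun x => by rw [Function.comp_apply]
  have hI : Continuous fun x : (ℝ × Plane) × Plane => M.incoming Ψ x.1.1 x.2 :=
    ((M.continuous_incoming hΨ).comp
      (by fun_prop : Continuous fun x : (ℝ × Plane) × Plane => (x.1.1, x.2))).congr
      fun x => by rw [Function.comp_apply]
  have h1 : Measurable fun y : ℝ × Plane => ∫ q : Plane,
      Complex.exp (-Complex.I * y.1 * ((⟪q, y.2 - M.xInt⟫_ℝ : ℝ) : ℂ) / (√ε : ℝ)) *
        M.transmitted δ φ y.1 q := by
    have hc : Continuous fun x : (ℝ × Plane) × Plane =>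
        Complex.exp (-Complex.I * x.1.1 * ((⟪x.2, x.1.2 - M.xInt⟫_ℝ : ℝ) : ℂ) / (√ε : ℝ)) *
          M.transmitted δ φ x.1.1 x.2 := Continuous.mul (by fun_prop) hT
    exact (hc.stronglyMeasurable.integral_prod_right' (ν := volume)).measurable
  have h2 : Measurable fun y : ℝ × Plane => ∫ q : Plane,
      Complex.exp (Complex.I * y.1 * ((⟪q, y.2 - M.xInt⟫_ℝ : ℝ) : ℂ) / (√ε : ℝ)) *
        M.incoming Ψ y.1 q := by
    have hc : Continuous fun x : (ℝ × Plane) × Plane =>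
        Complex.exp (Complex.I * x.1.1 * ((⟪x.2, x.1.2 - M.xInt⟫_ℝ : ℝ) : ℂ) / (√ε : ℝ)) *
          M.incoming Ψ x.1.1 x.2 := Continuous.mul (by fun_prop) hI
    exact (hc.stronglyMeasurable.integral_prod_right' (ν := volume)).measurable
  have h3 : Measurable fun x : (Ω × ℝ) × Plane => V x.1.1 ((ε ^ γ)⁻¹ • x.2) :=
    hV.comp (by fun_prop : Measurable fun x : (Ω × ℝ) × Plane => (x.1.1, (ε ^ γ)⁻¹ • x.2))
  have hp : Measurable fun x : (Ω × ℝ) × Plane => (x.1.2, x.2) := by fun_prop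
  have h4 : Measurable fun x : (Ω × ℝ) × Plane =>
      M.scatterIntegrand γ ε (M.slow 0 - M.slow 1) x.1.2 (V x.1.1) (M.transmitted δ φ x.1.2)
        (M.incoming Ψ x.1.2) x.2 := by
    have h1' := h1.comp hp
    have h2' := h2.comp hp
    simp only [Function.comp_def] at h1' h2'
    unfold scatterIntegrand
    exact Measurable.mul (Measurable.mul (by fun_prop) h1') h2'
  have h5 : Measurable fun p : Ω × ℝ => ∫ x : Plane,
      M.scatterIntegrand γ ε (M.slow 0 - M.slow 1) p.2 (V p.1) (M.transmitted δ φ p.2)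
        (M.incoming Ψ p.2) x :=
    (h4.stronglyMeasurable.integral_prod_right' (ν := volume)).measurable
  simp only [M.frontIntegrand_eq γ hε, scatter]
  exact (Measurable.mul (by fun_prop) h5).mul (by fun_prop)

end Bounds

/-! ### Homogenization at fixed frequency and after integration -/

section Limit

variable {Ω : Type*} [MeasurableSpace Ω] {P : Measure Ω} [IsProbabilityMeasure P]
  {V : Ω → Plane → ℝ} (hV : IsMixingField P V) {Ψ : ℝ × Plane → ℂ} (hΨ : IsAdmissibleSource Ψ)
include hV hΨ

/-- Averaging needs a fixed weight `h`, so the mode is split into its value at `δ = 0` and a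
remainder. The remainder is small by the deterministic `L²` bound, the fixed part by the law of
large numbers. -/
theorem tendsto_lintegral_frontIntegrand {γ : ℝ} (hγ : 1 / 2 < γ) (φ : 𝓢(ObsSpace, ℂ)) (ω : ℝ) :
    Tendsto (fun ε => ∫⁻ w, ‖M.frontIntegrand γ ε Ψ (V w) φ ω -
      M.limitIntegrand Ψ (elevationCharFun P V) φ ω‖ₑ ∂P) (𝓝[>] 0) (𝓝 0) := by
  -- The change of variables needs `ω ≠ 0`; at zero the factor `ω²` annihilates both integrands.
  rcases eq_or_ne ω 0 with rfl | hω
  · simp [frontIntegrand, limitIntegrand]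
  obtain ⟨hG, hG2⟩ := M.integrable_memLp_incoming hΨ ω
  set G := M.incoming Ψ ω with hGdef
  set F₀ := M.transmitted 0 φ ω with hF₀
  have h0 := M.integrable_transmitted 0 φ hω
  have h02 := M.memLp_transmitted 0 φ hω
  let F : ℝ → Plane → ℂ := fun ε => M.transmitted (ε ^ γ / √ε) φ ω - F₀
  have hF : ∀ ε, Integrable (F ε) := fun ε => (M.integrable_transmitted _ φ hω).sub h0
  have hF2 : ∀ ε, MemLp (F ε) 2 := fun ε => (M.memLp_transmitted _ φ hω).sub h02
  let h : Plane → ℂ := fun η => FourierTransform.fourier F₀ η * FourierTransformInv.fourierInv G η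
  have hh : Integrable h := integrable_fourier_mul_fourierInv h0 h02 hG hG2
  let τ := M.slow 0 - M.slow 1
  let X : ℝ → ENNReal := fun ε => ∫⁻ w, ‖∫ η, centredPhase P V (ω * τ) w
    ((ε ^ γ)⁻¹ • M.xInt + scaleRatio γ ε ω • η) * h η‖ₑ ∂P
  have hX : Tendsto X (𝓝[>] 0) (𝓝 0) :=
    hV.tendsto_lintegral_average (ω * τ) hh (tendsto_abs_scaleRatio hγ hω)
  have hY : Tendsto (fun ε => eLpNorm (F ε) 2 volume) (𝓝[>] 0) (𝓝 0) :=
    (M.tendsto_eLpNorm_transmitted_sub φ hω).comp (tendsto_scale_ratio_zero hγ)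
  have hbound : ∀ ε > 0, ∫⁻ w, ‖M.frontIntegrand γ ε Ψ (V w) φ ω -
      M.limitIntegrand Ψ (elevationCharFun P V) φ ω‖ₑ ∂P ≤
      (eLpNorm (F ε) 2 volume * eLpNorm G 2 volume + X ε) * ‖((ω ^ 2 : ℝ) : ℂ)‖ₑ := by
    intro ε hε
    have hsplit : ∀ w, M.frontIntegrand γ ε Ψ (V w) φ ω -
        M.limitIntegrand Ψ (elevationCharFun P V) φ ω =
        (M.scatter γ ε τ ω (V w) (F ε) G + ∫ η, centredPhase P V (ω * τ) w
          ((ε ^ γ)⁻¹ • M.xInt + scaleRatio γ ε ω • η) * h η) * ((ω ^ 2 : ℝ) : ℂ) := by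
      intro w
      have e1 : M.transmitted (ε ^ γ / √ε) φ ω = F ε + F₀ := (sub_add_cancel _ _).symm
      rw [M.frontIntegrand_eq γ hε, e1, M.scatter_add hε hω (V w) (hV.continuous w) (hF ε) (hF2 ε)
        h0 h02 hG hG2, ← M.scatter_sub_average hε hω P V w (hV.continuous w) h0 h02 hG hG2,
        limitIntegrand]
      ring
    calc ∫⁻ w, ‖M.frontIntegrand γ ε Ψ (V w) φ ω -
          M.limitIntegrand Ψ (elevationCharFun P V) φ ω‖ₑ ∂P
        ≤ ∫⁻ w, (eLpNorm (F ε) 2 volume * eLpNorm G 2 volume +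
          ‖∫ η, centredPhase P V (ω * τ) w
            ((ε ^ γ)⁻¹ • M.xInt + scaleRatio γ ε ω • η) * h η‖ₑ) * ‖((ω ^ 2 : ℝ) : ℂ)‖ₑ ∂P := by
          refine lintegral_mono fun w => ?_
          rw [hsplit w, enorm_mul]
          gcongr
          refine (enorm_add_le _ _).trans ?_
          gcongr
          exact M.enorm_scatter_le hε hω (V w) (hF ε) (hF2 ε) hG hG2
      _ = _ := by
          rw [lintegral_mul_const' _ _ enorm_ne_top, lintegral_add_left measurable_const,
            lintegral_const, measure_univ, mul_one]
  have hlim : Tendsto (fun ε => (eLpNorm (F ε) 2 volume * eLpNorm G 2 volume + X ε) *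
      ‖((ω ^ 2 : ℝ) : ℂ)‖ₑ) (𝓝[>] 0) (𝓝 0) := by
    have h1 := ENNReal.Tendsto.mul_const (b := eLpNorm G 2 volume) hY (Or.inr hG2.2.ne)
    have h2 := ENNReal.Tendsto.mul_const (b := ‖((ω ^ 2 : ℝ) : ℂ)‖ₑ) (h1.add hX)
      (Or.inr enorm_ne_top)
    simpa using h2
  refine tendsto_of_tendsto_of_tendsto_of_le_of_le' tendsto_const_nhds hlim
    (Eventually.of_forall fun _ => zero_le) ?_
  filter_upwards [self_mem_nhdsWithin] with ε hε using hbound ε hε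

theorem integrable_limitIntegrand (φ : 𝓢(ObsSpace, ℂ)) :
    Integrable (M.limitIntegrand Ψ (elevationCharFun P V) φ) := by
  -- The exponent 0 is arbitrary: only the bound on the limit integrand is used.
  obtain ⟨R, -, C, h⟩ := M.exists_integrand_bound hΨ 0 (norm_elevationCharFun_le (P := P) V)
  refine Integrable.mono' ((integrable_indicator_iff measurableSet_Icc).2
    (integrableOn_const (by simp)))
    (M.measurable_limitIntegrand hΨ hV.continuous_elevationCharFun φ).aestronglyMeasurable
    (ae_of_all _ fun ω => (h φ _ (fourierDecay_seminorm φ) ω).2)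

theorem integrable_frontIntegrand (γ : ℝ) {ε : ℝ} (hε : 0 < ε) (w : Ω) (φ : 𝓢(ObsSpace, ℂ)) :
    Integrable (M.frontIntegrand γ ε Ψ (V w) φ) := by
  obtain ⟨R, -, C, h⟩ := M.exists_integrand_bound hΨ γ (norm_elevationCharFun_le (P := P) V)
  have hm := (M.measurable_frontIntegrand hΨ hV.measurable_uncurry γ hε φ).comp
    (measurable_prodMk_left (x := w))
  exact Integrable.mono' ((integrable_indicator_iff measurableSet_Icc).2
    (integrableOn_const (by simp))) hm.aestronglyMeasurable
    (ae_of_all _ fun ω => (h φ _ (fourierDecay_seminorm φ) ω).1 ε hε (V w))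

theorem frontConverges (γ : ℝ) {ε : ℝ} (hε : 0 < ε) (w : Ω) (φ : 𝓢(ObsSpace, ℂ)) :
    M.FrontConverges γ ε Ψ (V w) φ := by
  refine ⟨fun ω hω => ?_, M.integrable_frontIntegrand hV hΨ γ hε w φ⟩
  obtain ⟨hG, hG2⟩ := M.integrable_memLp_incoming hΨ ω
  rw [M.testedMode_eq γ hε]
  exact ⟨M.integrable_transmitted _ φ hω, hG, M.integrable_scatterIntegrand hε hω _
    (hV.continuous w) (M.integrable_transmitted _ φ hω) (M.memLp_transmitted _ φ hω) hG hG2⟩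

omit [IsProbabilityMeasure P] in
theorem measurable_frontPairing (γ : ℝ) {ε : ℝ} (hε : 0 < ε) (φ : 𝓢(ObsSpace, ℂ)) :
    Measurable fun w => M.frontPairing γ ε Ψ (V w) φ := by
  have h := (M.measurable_frontIntegrand hΨ hV.measurable_uncurry γ hε φ).stronglyMeasurable
  exact (h.integral_prod_right' (ν := volume)).measurable.const_mul _

/-- Tonelli puts the expectation inside the frequency integral. The fixed-frequency limit and a
majorant supported in a compact interval then give dominated convergence. -/
theorem tendsto_lintegral_frontPairing {γ : ℝ} (hγ : 1 / 2 < γ) (φ : 𝓢(ObsSpace, ℂ)) :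
    Tendsto (fun ε => ∫⁻ w, ‖M.frontPairing γ ε Ψ (V w) φ - (M.prefactor : ℂ) *
      ∫ ω, M.limitIntegrand Ψ (elevationCharFun P V) φ ω‖ₑ ∂P) (𝓝[>] 0) (𝓝 0) := by
  obtain ⟨R, -, C, hb⟩ := M.exists_integrand_bound hΨ γ (norm_elevationCharFun_le (P := P) V)
  set A := 2 ^ 4 *
    ((Finset.Iic (4, 0)).sup (schwartzSeminormFamily ℂ EuclideanObs ℂ)) (obsFourier φ)
  set B : ℝ → ℝ := (Set.Icc (-R) R).indicator fun _ => C * A with hB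
  have hbd := hb φ A (fourierDecay_seminorm φ)
  have hBi : Integrable B := (integrable_indicator_iff measurableSet_Icc).2
    (integrableOn_const (by simp))
  have hmL := M.measurable_limitIntegrand hΨ hV.continuous_elevationCharFun φ
  let D : ℝ → Ω → ℝ → ENNReal := fun ε w ω => ‖M.frontIntegrand γ ε Ψ (V w) φ ω -
    M.limitIntegrand Ψ (elevationCharFun P V) φ ω‖ₑ
  have hDm : ∀ ε > 0, Measurable fun p : Ω × ℝ => D ε p.1 p.2 := fun ε hε =>
    ((M.measurable_frontIntegrand hΨ hV.measurable_uncurry γ hε φ).sub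
      (hmL.comp measurable_snd)).enorm
  have hDb : ∀ ε > 0, ∀ w ω, D ε w ω ≤ ‖2 * B ω‖ₑ := by
    intro ε hε w ω
    obtain ⟨h1, h2⟩ := hbd ω
    rw [enorm_le_iff_norm_le]
    refine (norm_sub_le _ _).trans (le_trans ?_ (le_abs_self _))
    linarith [h1 ε hε (V w)]
  have hlim : Tendsto (fun ε => ∫⁻ ω, ∫⁻ w, D ε w ω ∂P) (𝓝[>] 0) (𝓝 0) := by
    rw [show (0 : ENNReal) = ∫⁻ _ : ℝ, 0 by simp]
    refine tendsto_lintegral_filter_of_dominated_convergence (fun ω => ‖2 * B ω‖ₑ) ?_ ?_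
      (hBi.const_mul 2).2.ne (ae_of_all _ fun ω =>
        M.tendsto_lintegral_frontIntegrand hV hΨ hγ φ ω)
    · filter_upwards [self_mem_nhdsWithin] with ε hε
      exact ((hDm ε hε).comp measurable_swap).lintegral_prod_right'
    · filter_upwards [self_mem_nhdsWithin] with ε hε
      refine ae_of_all _ fun ω => ?_
      exact (lintegral_mono fun w => hDb ε hε w ω).trans (by simp)
  have hlim' := ENNReal.Tendsto.const_mul (a := ‖(M.prefactor : ℂ)‖ₑ) hlim (Or.inr enorm_ne_top)
  rw [mul_zero] at hlim'
  refine tendsto_of_tendsto_of_tendsto_of_le_of_le' tendsto_const_nhds hlim'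
    (Eventually.of_forall fun _ => zero_le) ?_
  filter_upwards [self_mem_nhdsWithin] with ε hε
  rw [← lintegral_lintegral_swap (f := fun w ω => D ε w ω) (hDm ε hε).aemeasurable,
    ← lintegral_const_mul' _ _ enorm_ne_top]
  refine lintegral_mono fun w => ?_
  rw [frontPairing, ← mul_sub, ← integral_sub (M.integrable_frontIntegrand hV hΨ γ hε w φ)
    (M.integrable_limitIntegrand hV hΨ φ), enorm_mul]
  gcongr
  exact enorm_integral_le_lintegral_enorm _

end Limit

/-! ### The homogenized profile -/

section Profile

variable {Ψ : ℝ × Plane → ℂ} (hΨ : IsAdmissibleSource Ψ) {χ : ℝ → ℂ} (hχ : Continuous χ)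

/-- The amplitude of the homogenized mode `(ω, q)`. -/
noncomputable def profileAmplitude (Ψ : ℝ × Plane → ℂ) (χ : ℝ → ℂ) (p : ℝ × Plane) : ℂ :=
  M.propagator 1 p.1 p.2 (M.zTr - M.zInt) * M.propagator 0 p.1 p.2 M.zInt *
    χ (p.1 * (M.slow 0 - M.slow 1)) * sourceTransform Ψ p.1 p.2 * ((p.1 ^ 2 : ℝ) : ℂ)

theorem profileIntegrand_eq (Ψ : ℝ × Plane → ℂ) (χ : ℝ → ℂ) (s : ℝ) (y : Plane) (p : ℝ × Plane) :
    M.profileIntegrand Ψ χ s y p =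
      Complex.exp (-Complex.I * p.1 * ((s - ⟪p.2, y⟫_ℝ : ℝ) : ℂ)) * M.profileAmplitude Ψ χ p := by
  rw [profileIntegrand, profileAmplitude]; ring

theorem norm_exp_neg_I_mul (a b : ℝ) : ‖Complex.exp (-Complex.I * a * (b : ℂ))‖ = 1 := by
  rw [show -Complex.I * a * (b : ℂ) = Complex.I * ((-(a * b) : ℝ) : ℂ) by push_cast; ring,
    norm_exp_I_mul_ofReal]

include hΨ hχ

theorem integrable_profileAmplitude : Integrable (M.profileAmplitude Ψ χ) := by
  have hcont : Continuous (M.profileAmplitude Ψ χ) := by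
    unfold profileAmplitude
    exact ((((M.continuous_propagator 1 _).mul (M.continuous_propagator 0 _)).mul
      (hχ.comp (by fun_prop))).mul (continuous_sourceTransform hΨ.integrable)).mul (by fun_prop)
  refine hcont.integrable_of_hasCompactSupport ?_
  unfold profileAmplitude
  exact (hΨ.compactSupport.mul_left (f := fun p : ℝ × Plane =>
    M.propagator 1 p.1 p.2 (M.zTr - M.zInt) * M.propagator 0 p.1 p.2 M.zInt *
      χ (p.1 * (M.slow 0 - M.slow 1)))).mul_right

theorem integrable_profileIntegrand (s : ℝ) (y : Plane) :
    Integrable (M.profileIntegrand Ψ χ s y) := by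
  simp_rw [funext (M.profileIntegrand_eq Ψ χ s y)]
  exact (M.integrable_profileAmplitude hΨ hχ).bdd_mul (c := 1)
    (Continuous.aestronglyMeasurable (by fun_prop))
    (ae_of_all _ fun p => (norm_exp_neg_I_mul _ _).le)

theorem integrable_profileIntegrand_mul (φ : 𝓢(ObsSpace, ℂ)) :
    Integrable (fun z : ObsSpace × (ℝ × Plane) =>
      M.profileIntegrand Ψ χ z.1.1 z.1.2.1 z.2 * φ z.1) (volume.prod volume) := by
  have h1 : Integrable (fun z : ObsSpace × (ℝ × Plane) => φ z.1 * M.profileAmplitude Ψ χ z.2)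
      (volume.prod volume) := (integrable_testFunction φ).mul_prod (M.integrable_profileAmplitude hΨ hχ)
  have h2 : Continuous fun z : ObsSpace × (ℝ × Plane) =>
      Complex.exp (-Complex.I * z.2.1 * ((z.1.1 - ⟪z.2.2, z.1.2.1⟫_ℝ : ℝ) : ℂ)) := by fun_prop
  refine (h1.bdd_mul (c := 1) h2.aestronglyMeasurable
    (ae_of_all _ fun p => (norm_exp_neg_I_mul _ _).le)).congr (ae_of_all _ fun z => ?_)
  simp only [profileIntegrand_eq]
  ring

theorem integrable_profile_mul (φ : 𝓢(ObsSpace, ℂ)) :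
    Integrable fun p : ObsSpace => M.profile Ψ χ p.1 p.2.1 * φ p := by
  refine ((M.integrable_profileIntegrand_mul hΨ hχ φ).integral_prod_left.const_mul
    (M.prefactor : ℂ)).congr (ae_of_all _ fun p => ?_)
  simp only [profile]
  rw [integral_mul_const, mul_assoc]

/-- By Fubini the test function is integrated first. As the profile does not involve `ỹ`, this
produces the mode transform at `δ = 0`, the one reached in the limit. -/
theorem integral_profile_mul (φ : 𝓢(ObsSpace, ℂ)) :
    ∫ p : ObsSpace, M.profile Ψ χ p.1 p.2.1 * φ p =
      (M.prefactor : ℂ) * ∫ ω, M.limitIntegrand Ψ χ φ ω := by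
  have hI := M.integrable_profileIntegrand_mul hΨ hχ φ
  have e1 : ∀ p : ObsSpace, M.profile Ψ χ p.1 p.2.1 * φ p = (M.prefactor : ℂ) *
      ∫ k : ℝ × Plane, M.profileIntegrand Ψ χ p.1 p.2.1 k * φ p := fun p => by
    rw [profile, integral_mul_const, mul_assoc]
  have e2 : ∀ k : ℝ × Plane, ∫ p : ObsSpace, M.profileIntegrand Ψ χ p.1 p.2.1 k * φ p =
      M.profileAmplitude Ψ χ k * modeTransform 0 φ k.1 k.2 := fun k => by
    rw [modeTransform, ← integral_const_mul]
    refine integral_congr_ae (ae_of_all _ fun p => ?_)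
    simp only [profileIntegrand_eq, zero_mul, sub_zero]
    ring
  simp_rw [e1]
  rw [integral_const_mul, integral_integral_swap (f := fun (p : ObsSpace) (k : ℝ × Plane) =>
    M.profileIntegrand Ψ χ p.1 p.2.1 k * φ p) hI]
  simp_rw [e2]
  have hI2 : Integrable (fun k : ℝ × Plane =>
      M.profileAmplitude Ψ χ k * modeTransform 0 φ k.1 k.2) (volume.prod volume) :=
    hI.integral_prod_right.congr (ae_of_all _ e2)
  rw [Measure.volume_eq_prod, integral_prod _ hI2]
  refine congrArg _ (integral_congr_ae (ae_of_all _ fun ω => ?_))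
  simp only [limitIntegrand, profileAmplitude, transmitted, incoming]
  rw [← integral_const_mul, ← integral_mul_const]
  refine integral_congr_ae (ae_of_all _ fun q => ?_)
  ring

end Profile

end Setup

end RoughInterface

/-! ### Assembly of the main theorem -/

theorem mainTheorem10 {Ω : Type*} [MeasurableSpace Ω] (P : MeasureTheory.Measure Ω)
    [MeasureTheory.IsProbabilityMeasure P]
    (V : Ω → RoughInterface.Plane → ℝ) (hV : RoughInterface.IsMixingField P V)
    (Ψ : ℝ × RoughInterface.Plane → ℂ) (hΨ : RoughInterface.IsAdmissibleSource Ψ)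
    (M : RoughInterface.Setup) (γ : ℝ) (hγ : 1 / 2 < γ) :
    (∀ ε > 0, ∀ w φ, M.FrontConverges γ ε Ψ (V w) φ) ∧
    (∀ s y, MeasureTheory.Integrable
      (M.profileIntegrand Ψ (RoughInterface.elevationCharFun P V) s y)) ∧
    ∃ (Uε : ℝ → Ω → RoughInterface.TemperedDist) (U : RoughInterface.TemperedDist),
      (∀ ε > 0, ∀ w φ, Uε ε w φ = M.frontPairing γ ε Ψ (V w) φ) ∧
      (∀ ε > 0, ∀ φ, Measurable fun w => Uε ε w φ) ∧
      (∀ φ : SchwartzMap RoughInterface.ObsSpace ℂ,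
        MeasureTheory.Integrable (fun p : RoughInterface.ObsSpace =>
          M.profile Ψ (RoughInterface.elevationCharFun P V) p.1 p.2.1 * φ p) ∧
        U φ = ∫ p : RoughInterface.ObsSpace,
          M.profile Ψ (RoughInterface.elevationCharFun P V) p.1 p.2.1 * φ p) ∧
      RoughInterface.TendstoInProbability P Uε U := by
  have hχ := hV.continuous_elevationCharFun
  refine ⟨fun ε hε w φ => M.frontConverges hV hΨ γ hε w φ,
    M.integrable_profileIntegrand hΨ hχ, ?_⟩
  obtain ⟨R, hR, C, hbd⟩ :=
    M.exists_integrand_bound hΨ γ (RoughInterface.norm_elevationCharFun_le (P := P) V)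
  set K : ℝ := ‖(M.prefactor : ℂ)‖ * (2 * R * C) with hK
  obtain ⟨U, hU, hUb⟩ := RoughInterface.exists_temperedDist_of_bound (M.prefactor : ℂ)
    (M.limitIntegrand Ψ (RoughInterface.elevationCharFun P V)) (M.limitIntegrand_add hΨ _)
    (M.limitIntegrand_smul _) (M.integrable_limitIntegrand hV hΨ) hR
    (fun φ A hA ω => (hbd φ A hA ω).2)
  -- For `ε ≤ 0` the zero distribution is a harmless default, which lets the choice range over all
  -- real `ε`.
  have hex : ∀ (ε : ℝ) (w : Ω), ∃ T : RoughInterface.TemperedDist, 0 < ε →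
      (∀ φ, T φ = M.frontPairing γ ε Ψ (V w) φ) ∧
      ∀ φ A, RoughInterface.FourierDecay φ A → ‖T φ‖ ≤ K * A := by
    intro ε w
    rcases lt_or_ge 0 ε with hε | hε
    · obtain ⟨T, hT, hTb⟩ := RoughInterface.exists_temperedDist_of_bound (M.prefactor : ℂ)
        (M.frontIntegrand γ ε Ψ (V w)) (M.frontIntegrand_add hΨ γ hε (hV.continuous w))
        (M.frontIntegrand_smul γ hε (V w)) (M.integrable_frontIntegrand hV hΨ γ hε w) hR
        (fun φ A hA ω => (hbd φ A hA ω).1 ε hε (V w))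
      exact ⟨T, fun _ => ⟨hT, hTb⟩⟩
    · exact ⟨0, fun h => absurd h (not_lt.2 hε)⟩
  choose Uε hUε using hex
  refine ⟨Uε, U, fun ε hε w => (hUε ε w hε).1, fun ε hε φ => ?_, fun φ => ?_, ?_⟩
  · simp_rw [(hUε ε _ hε).1]
    exact M.measurable_frontPairing hV hΨ γ hε φ
  · exact ⟨M.integrable_profile_mul hΨ hχ φ,
      (hU φ).trans (M.integral_profile_mul hΨ hχ φ).symm⟩
  · refine RoughInterface.tendstoInProbability_of_forall P (fun ε hε w => (hUε ε w hε).2) hUb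
      fun φ r hr => ?_
    have hlim := M.tendsto_lintegral_frontPairing hV hΨ hγ φ
    -- Markov's inequality, with the factor `1/r`, turns convergence in `L¹(P)` into convergence in
    -- probability.
    have hlim' := ENNReal.Tendsto.mul_const (b := (ENNReal.ofReal r)⁻¹) hlim
      (Or.inr (ENNReal.inv_ne_top.2 (ENNReal.ofReal_pos.2 hr).ne'))
    rw [zero_mul] at hlim'
    refine tendsto_of_tendsto_of_tendsto_of_le_of_le' tendsto_const_nhds hlim'
      (Filter.Eventually.of_forall fun _ => zero_le) ?_
    filter_upwards [self_mem_nhdsWithin] with ε hε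
    have hm : Measurable fun w => ‖M.frontPairing γ ε Ψ (V w) φ - U φ‖ₑ :=
      ((M.measurable_frontPairing hV hΨ γ hε φ).sub_const _).enorm
    have := MeasureTheory.meas_ge_le_lintegral_div hm.aemeasurable
      (ENNReal.ofReal_pos.2 hr).ne' ENNReal.ofReal_ne_top (μ := P)
    rw [hU φ, div_eq_mul_inv] at this
    refine le_trans (MeasureTheory.measure_mono fun w hw => ?_) this
    have hw' : r ≤ ‖Uε ε w φ - U φ‖ := hw
    rw [(hUε ε w hε).1, hU φ] at hw'
    change ENNReal.ofReal r ≤ _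
    rw [← ofReal_norm]
    exact ENNReal.ofReal_le_ofReal hw'
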